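/- Let $p\neq 2,3$ be a prime, $F$ a field of characteristic $p$, $m\ge 1$ and $n=2m$. For $1\le j\le n$ put $\sigma(j)=1$, $j'=j+m$ if $j\le m$, and $\sigma(j)=-1$, $j'=j-m$ if $j>m$. Let $A(n)=F[x_1,\dots,x_n]/(x_1^p,\dots,x_n^p)$ with the Lie bracket $[f,g]=\sum_{j=1}^{n}\sigma(j)D_j(f)D_{j'}(g)$, where $D_j=\partial/\partial x_j$; let $H'(n)=A(n)/\langle 1\rangle_F$ and let $H(n)=[H'(n),H'(n)]$ be the Hamiltonian algebra, which has as a basis the (classes of the) monomials $x^a=x_1^{a_1}\cdots x_n^{a_n}$ with $0\le a_k\le p-1$ for all $k$ and $a\neq(0,\dots,0)$, $a\ne\sigma:=(p-1,\dots,p-1)$. Write $\epsilon_i$ for the $i$-th unit vector in $\mathbb{N}^n$ and $\deg(x^a)=\sum_k a_k-2$. Define bilinear maps $H(n)\times H(n)\to F$ on these basis monomials, all values that are not listed being zero, by $$\Omega_i(x^a,x^b)=a_i \ \text{ if } a+b=\sigma+\epsilon_i-(p-1)\epsilon_{i'}\quad(1\le i\le n),$$ $$\Sigma(x_k,x_{k'})=\sigma(k)\quad(1\le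 k\le n),\qquad \Delta(x^a,x^b)=\deg(x^a)\ \text{ if } a+b=\sigma.$$ Then, for the trivial $H(n)$-module $F$: (a) If $n\not\equiv-4 \pmod p$, then $\Omega_1,\dots,\Omega_n,\Sigma$ are 2-cocycles and their classes form a basis of $H^2(H(n),F)$; in particular $\dim_F H^2(H(n),F)=n+1$. (b) If $n\equiv-4 \pmod p$, then $\Omega_1,\dots,\Omega_n,\Sigma,\Delta$ are 2-cocycles and their classes form a basis of $H^2(H(n),F)$; in particular $\dim_F H^2(H(n),F)=n+2$. (c) $\Delta$ is alternating (that is, a 2-cochain) if and only if $n\equiv-4 \pmod p$. -/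

import Mathlib

set_option maxSynthPendingDepth 3

namespace HamiltonianLie

/-- The index set of the `n = 2m` variables: `inl i` is the index `i` and `inr i` is the index
`i + m`, for `1 ≤ i ≤ m`. -/
abbrev Idx (m : ℕ) : Type := Fin m ⊕ Fin m

/-- The conjugate `j ↦ j'`, which exchanges `i` and `i + m`. -/
def conj {m : ℕ} (j : Idx m) : Idx m := j.swap

/-- The sign `σ(j)`, which is `1` for `j ≤ m` and `-1` for `j > m`. -/
def sgn {m : ℕ} (j : Idx m) : ℤ := Sum.elim (fun _ => 1) (fun _ => -1) j

section TruncatedPolynomials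

variable (F : Type*) [Field F] (p m : ℕ)

/-- The ideal `(x_1 ^ p, …, x_n ^ p)`. -/
noncomputable def truncIdeal : Ideal (MvPolynomial (Idx m) F) :=
  Ideal.span (Set.range fun j => (MvPolynomial.X j : MvPolynomial (Idx m) F) ^ p)

/-- The algebra `A(n) = F[x_1, …, x_n] / (x_1 ^ p, …, x_n ^ p)` of truncated polynomials. -/
def TruncPoly : Type _ := MvPolynomial (Idx m) F ⧸ truncIdeal F p m

noncomputable instance : CommRing (TruncPoly F p m) :=
  inferInstanceAs (CommRing (MvPolynomial (Idx m) F ⧸ truncIdeal F p m))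

noncomputable instance : Algebra F (TruncPoly F p m) :=
  inferInstanceAs (Algebra F (MvPolynomial (Idx m) F ⧸ truncIdeal F p m))

/-- The quotient map `F[x_1, …, x_n] → A(n)`. -/
noncomputable def truncMk : MvPolynomial (Idx m) F →ₐ[F] TruncPoly F p m :=
  Ideal.Quotient.mkₐ F (truncIdeal F p m)

theorem truncMk_surjective : Function.Surjective (truncMk F p m) :=
  Ideal.Quotient.mkₐ_surjective F (truncIdeal F p m)

theorem truncMk_eq_zero_iff (f : MvPolynomial (Idx m) F) :
    truncMk F p m f = 0 ↔ f ∈ truncIdeal F p m :=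
  Ideal.Quotient.eq_zero_iff_mem

theorem coeff_eq_zero_of_mem_truncIdeal {f : MvPolynomial (Idx m) F} (hf : f ∈ truncIdeal F p m)
    (d : Idx m →₀ ℕ) (hd : ∀ k, d k < p) : MvPolynomial.coeff d f = 0 := by
  unfold truncIdeal at hf
  induction hf using Submodule.span_induction generalizing d with
  | mem x hx =>
    obtain ⟨j, rfl⟩ := hx
    simp only [MvPolynomial.X_pow_eq_monomial, MvPolynomial.coeff_monomial]
    rw [if_neg]
    rintro rfl
    simpa using hd j
  | zero => simp
  | add x y _ _ hx hy => simp [hx d hd, hy d hd]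
  | smul r x _ hx =>
    rw [smul_eq_mul, MvPolynomial.coeff_mul]
    refine Finset.sum_eq_zero fun e he => ?_
    rw [hx e.2 fun k => ?_, mul_zero]
    have h := DFunLike.congr_fun (Finset.HasAntidiagonal.mem_antidiagonal.1 he) k
    have h' := hd k
    simp only [Finsupp.add_apply] at h
    omega

/-- The coefficient of `x ^ a`, for an exponent `a` with all entries `< p`, as a linear form
on `A(n)`. -/
noncomputable def coeffA (a : Idx m → Fin p) : TruncPoly F p m →ₗ[F] F :=
  Submodule.liftQ ((truncIdeal F p m).restrictScalars F)
    (MvPolynomial.lcoeff F (Finsupp.equivFunOnFinite.symm fun k => (a k : ℕ)))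
    fun _ hf => coeff_eq_zero_of_mem_truncIdeal F p m hf _ fun k => (a k).isLt

theorem coeffA_truncMk (a : Idx m → Fin p) (f : MvPolynomial (Idx m) F) :
    coeffA F p m a (truncMk F p m f) =
      MvPolynomial.coeff (Finsupp.equivFunOnFinite.symm fun k => (a k : ℕ)) f :=
  rfl

variable [CharP F p]

theorem truncMk_pderiv_eq_zero (j : Idx m) (f : MvPolynomial (Idx m) F)
    (hf : truncMk F p m f = 0) : truncMk F p m (MvPolynomial.pderiv j f) = 0 := by
  rw [truncMk_eq_zero_iff] at hf
  unfold truncIdeal at hf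
  induction hf using Submodule.span_induction with
  | mem x hx =>
    obtain ⟨i, rfl⟩ := hx
    simp
  | zero => simp
  | add x y _ _ hx hy => simp [hx, hy]
  | smul r x hx ih =>
    have h : truncMk F p m x = 0 := (truncMk_eq_zero_iff F p m x).2 hx
    simp [ih, h]

/-- The partial derivative `D_j = ∂/∂x_j` of `A(n)`. -/
noncomputable def partialD (j : Idx m) : Derivation F (TruncPoly F p m) (TruncPoly F p m) :=
  Derivation.liftOfSurjective (truncMk_surjective F p m) (truncMk_pderiv_eq_zero F p m j)

theorem partialD_truncMk (j : Idx m) (f : MvPolynomial (Idx m) F) :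
    partialD F p m j (truncMk F p m f) = truncMk F p m (MvPolynomial.pderiv j f) :=
  Derivation.liftOfSurjective_apply (truncMk_surjective F p m)
    (truncMk_pderiv_eq_zero F p m j) f

theorem partialD_comm (i j : Idx m) (f : TruncPoly F p m) :
    partialD F p m i (partialD F p m j f) = partialD F p m j (partialD F p m i f) := by
  obtain ⟨f, rfl⟩ := truncMk_surjective F p m f
  simp only [partialD_truncMk]
  congr 1
  have h : ⁅MvPolynomial.pderiv (R := F) i, MvPolynomial.pderiv (R := F) j⁆ = 0 := by
    ext k
    simp [Derivation.commutator_apply, MvPolynomial.pderiv_X, Pi.single_apply, apply_ite]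
  have h' := DFunLike.congr_fun h f
  rw [Derivation.commutator_apply] at h'
  exact sub_eq_zero.1 h'

/-- `D_H(f) = ∑_j σ(j) D_j(f) D_{j'}`, a derivation of `A(n)`. -/
noncomputable def hamD (f : TruncPoly F p m) : Derivation F (TruncPoly F p m) (TruncPoly F p m) :=
  ∑ j : Idx m, sgn j • (partialD F p m j f • partialD F p m (conj j))

theorem hamD_apply (f g : TruncPoly F p m) :
    hamD F p m f g = ∑ i : Fin m,
      (partialD F p m (.inl i) f * partialD F p m (.inr i) g -
        partialD F p m (.inr i) f * partialD F p m (.inl i) g) := by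
  have h : ∀ s : Finset (Idx m), ∀ D : Idx m → Derivation F (TruncPoly F p m) (TruncPoly F p m),
      (∑ j ∈ s, D j) g = ∑ j ∈ s, D j g := fun s D => by
    rw [← Derivation.coeFnAddMonoidHom_apply, map_sum, Finset.sum_apply]
    rfl
  rw [hamD, h, Fintype.sum_sum_type, ← Finset.sum_add_distrib]
  refine Finset.sum_congr rfl fun i _ => ?_
  simp [sgn, conj, sub_eq_add_neg]

/-- The Lie bracket `[f, g] = D_H(f)(g)` on `A(n)`. -/
noncomputable instance : Bracket (TruncPoly F p m) (TruncPoly F p m) :=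
  ⟨fun f g => hamD F p m f g⟩

theorem bracket_def (f g : TruncPoly F p m) : ⁅f, g⁆ = hamD F p m f g := rfl

theorem jacobi (f g h : TruncPoly F p m) : ⁅f, ⁅g, h⁆⁆ = ⁅⁅f, g⁆, h⁆ + ⁅g, ⁅f, h⁆⁆ := by
  let D := partialD F p m
  let P : Fin m → Fin m → TruncPoly F p m := fun x i =>
    D (.inl x) g * (D (.inl i) f * D (.inr i) (D (.inr x) h)
      - D (.inr i) f * D (.inl i) (D (.inr x) h))
    - D (.inr x) g * (D (.inl i) f * D (.inr i) (D (.inl x) h)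
      - D (.inr i) f * D (.inl i) (D (.inl x) h))
  let Q : Fin m → Fin m → TruncPoly F p m := fun x i =>
    D (.inr x) h * (D (.inl i) f * D (.inr i) (D (.inl x) g)
      - D (.inr i) f * D (.inl i) (D (.inl x) g))
    - D (.inl x) h * (D (.inl i) f * D (.inr i) (D (.inr x) g)
      - D (.inr i) f * D (.inl i) (D (.inr x) g))
  have e₁ : ⁅f, ⁅g, h⁆⁆ = (∑ x, ∑ i, P x i) + ∑ x, ∑ i, Q x i := by
    simp only [bracket_def, hamD_apply, map_sum, map_sub, Derivation.leibniz, smul_eq_mul]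
    simp only [← Finset.sum_add_distrib]
    refine Finset.sum_congr rfl fun x _ => ?_
    simp only [Finset.mul_sum, ← Finset.sum_sub_distrib, ← Finset.sum_add_distrib]
    refine Finset.sum_congr rfl fun i _ => ?_
    simp only [P, Q, D]
    ring
  have e₂ : ⁅⁅f, g⁆, h⁆ + ⁅g, ⁅f, h⁆⁆ = (∑ x, ∑ i, P i x) + ∑ x, ∑ i, Q x i := by
    simp only [bracket_def, hamD_apply, map_sum, map_sub, Derivation.leibniz, smul_eq_mul]
    simp only [← Finset.sum_add_distrib]
    refine Finset.sum_congr rfl fun x _ => ?_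
    simp only [Finset.mul_sum, Finset.sum_mul, ← Finset.sum_sub_distrib,
      ← Finset.sum_add_distrib]
    refine Finset.sum_congr rfl fun i _ => ?_
    simp only [P, Q, D]
    rw [partialD_comm F p m (.inr i) (.inr x) h, partialD_comm F p m (.inl i) (.inr x) h,
      partialD_comm F p m (.inr i) (.inl x) h, partialD_comm F p m (.inl i) (.inl x) h,
      partialD_comm F p m (.inr i) (.inr x) g, partialD_comm F p m (.inl i) (.inr x) g,
      partialD_comm F p m (.inr i) (.inl x) g, partialD_comm F p m (.inl i) (.inl x) g,
      partialD_comm F p m (.inr i) (.inr x) f, partialD_comm F p m (.inl i) (.inr x) f,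
      partialD_comm F p m (.inr i) (.inl x) f, partialD_comm F p m (.inl i) (.inl x) f]
    ring
  rw [e₁, e₂, Finset.sum_comm (f := P)]

/-- `A(n)` with the bracket `[f, g] = D_H(f)(g)` is a Lie ring. -/
noncomputable instance : LieRing (TruncPoly F p m) where
  add_lie f g h := by
    simp only [bracket_def, hamD_apply, map_add, ← Finset.sum_add_distrib]
    exact Finset.sum_congr rfl fun _ _ => by ring
  lie_add f g h := by simp only [bracket_def, map_add]
  lie_self f := by
    rw [bracket_def, hamD_apply]
    exact Finset.sum_eq_zero fun _ _ => by ring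
  leibniz_lie f g h := jacobi F p m f g h

noncomputable instance : LieAlgebra F (TruncPoly F p m) where
  lie_smul c f g := by simp only [bracket_def, Derivation.map_smul]

/-- The central ideal `⟨1⟩` of `A(n)`. -/
noncomputable def constIdeal : LieIdeal F (TruncPoly F p m) where
  __ := Submodule.span F {(1 : TruncPoly F p m)}
  lie_mem := by
    intro f g hg
    obtain ⟨c, rfl⟩ := Submodule.mem_span_singleton.1 hg
    have h : ⁅f, c • (1 : TruncPoly F p m)⁆ = 0 := by simp [bracket_def]
    rw [h]
    exact Submodule.zero_mem _

/-- The Lie algebra `H'(n) = A(n) / ⟨1⟩`. -/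
abbrev HPrime : Type _ := TruncPoly F p m ⧸ constIdeal F p m

/-- The Hamiltonian algebra `H(n) = [H'(n), H'(n)]`, the derived subalgebra of `H'(n)`. -/
abbrev HAlg : Type _ := (⁅(⊤ : LieIdeal F (HPrime F p m)), (⊤ : LieIdeal F (HPrime F p m))⁆ :
  LieIdeal F (HPrime F p m))

end TruncatedPolynomials

section Cohomology

open LieModule.Cohomology

variable (R L M : Type*) [CommRing R] [LieRing L] [LieAlgebra R L] [AddCommGroup M] [Module R M]
  [LieRingModule L M] [LieModule R L M]

/-- The second Lie algebra cohomology `H²(L, M)`: the 2-cocycles modulo the 2-coboundaries. -/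
abbrev H2 : Type _ :=
  twoCocycle R L M ⧸ (LinearMap.range (d₁₂ R L M)).submoduleOf (twoCocycle R L M)

variable {R L M}

/-- The bilinear map `c` is a 2-cocycle (in particular alternating), and `h` is its cohomology
class. -/
def IsClassOf (c : L →ₗ[R] L →ₗ[R] M) (h : H2 R L M) : Prop :=
  ∃ z : twoCocycle R L M, ((z : twoCochain R L M) : L →ₗ[R] L →ₗ[R] M) = c ∧
    Submodule.Quotient.mk z = h

end Cohomology

section Cochains

/-- The exponents `a` with `0 ≤ a ≤ (p-1, …, p-1)` and `a ≠ 0`, `a ≠ (p-1, …, p-1)`: those of the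
monomials `x ^ a` in `H(n)`. -/
abbrev Expo (p m : ℕ) : Type :=
  {a : Idx m → Fin p // (∃ k, (a k : ℕ) ≠ 0) ∧ ∃ k, (a k : ℕ) ≠ p - 1}

/-- The exponent as a function with values in `ℕ`. -/
def Expo.toNat {p m : ℕ} (a : Expo p m) : Idx m → ℕ := fun k => (a.1 k : ℕ)

/-- The degree `deg(x ^ a) = |a| - 2`. -/
def Expo.deg {p m : ℕ} (a : Expo p m) : ℤ := (∑ k, (a.toNat k : ℤ)) - 2

variable (F : Type*) [Field F] (p m : ℕ) [CharP F p]

/-- The coefficient of `x ^ a`, as a linear form on `H'(n)`. -/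
noncomputable def coeffHPrime (a : Expo p m) : HPrime F p m →ₗ[F] F :=
  Submodule.liftQ (constIdeal F p m).toSubmodule (coeffA F p m a.1) (by
    refine (Submodule.span_singleton_le_iff_mem _ _).2 ?_
    rw [LinearMap.mem_ker, ← map_one (truncMk F p m), coeffA_truncMk, MvPolynomial.coeff_one,
      if_neg]
    intro h
    obtain ⟨k, hk⟩ := a.2.1
    exact hk (DFunLike.congr_fun h k).symm)

/-- The coefficient of `x ^ a`, as a linear form on `H(n)`. -/
noncomputable def coeffH (a : Expo p m) : HAlg F p m →ₗ[F] F :=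
  coeffHPrime F p m a ∘ₗ (LieSubmodule.toSubmodule
    ⁅(⊤ : LieIdeal F (HPrime F p m)), (⊤ : LieIdeal F (HPrime F p m))⁆).subtype

/-- The field `F` as the trivial `H(n)`-module. -/
abbrev TrivF : Type _ := TrivialLieModule F (HAlg F p m) F

/-- The bilinear map `H(n) × H(n) → F` with the value `φ a b` at `(x ^ a, x ^ b)`. -/
noncomputable def bilin (φ : Expo p m → Expo p m → F) :
    HAlg F p m →ₗ[F] HAlg F p m →ₗ[F] TrivF F p m :=
  ∑ a : Expo p m, ∑ b : Expo p m, (coeffH F p m a).smulRight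
    (φ a b • ((TrivialLieModule.equiv F (HAlg F p m) F).symm.toLinearMap ∘ₗ coeffH F p m b))

open Classical in
/-- `Ω_i(x ^ a, x ^ b) = a_i` if `a + b = σ + ε_i - (p-1) ε_{i'}`, where `σ = (p-1, …, p-1)`;
all other values are zero. -/
noncomputable def omegaCochain (i : Idx m) : HAlg F p m →ₗ[F] HAlg F p m →ₗ[F] TrivF F p m :=
  bilin F p m fun a b =>
    if a.toNat + b.toNat + Pi.single (conj i) (p - 1) = (fun _ => p - 1) + Pi.single i 1 then
      (a.toNat i : F) else 0

open Classical in
/-- `Σ(x_k, x_{k'}) = σ(k)` for all `k`; all other values are zero. -/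
noncomputable def sigmaCochain : HAlg F p m →ₗ[F] HAlg F p m →ₗ[F] TrivF F p m :=
  bilin F p m fun a b =>
    ∑ k : Idx m, if a.toNat = Pi.single k 1 ∧ b.toNat = Pi.single (conj k) 1 then (sgn k : F) else 0

open Classical in
/-- `Δ(x ^ a, x ^ b) = deg(x ^ a)` if `a + b = σ`, where `σ = (p-1, …, p-1)`; all other values
are zero. -/
noncomputable def deltaCochain : HAlg F p m →ₗ[F] HAlg F p m →ₗ[F] TrivF F p m :=
  bilin F p m fun a b => if a.toNat + b.toNat = fun _ => p - 1 then (a.deg : F) else 0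

end Cochains

end HamiltonianLie

/-! Write ∫ f for the coefficient of x^σ in f. A bracket is a sum of partial derivatives, so ∫
vanishes on brackets, and H(n) is the hyperplane ∫ f = 0 modulo the constants. The form ∫ fg is
invariant and its radical on that hyperplane is the line of constants, so H(n) is self-dual. Every
bilinear form is therefore c(f, g) = ∫ D(f) g for a linear map D of A(n), and if c is a 2-cocycle, D
induces a derivation from H(n) to A(n)/⟨1⟩ (`ofCochain_mem`). The problem becomes the classification
of these derivations.

By `exists_of_mem_derModConsts` they are spanned by ad g with g in A(n), the maps x_{i'}^{p-1} ∂_i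
and the degree derivation. The values of D on the variables form a 1-form that is closed up to
constants. `exists_potential` integrates it up to the forms x_k^{p-1} dx_k, which accounts for ad g
and the powers; a linear skew remainder is scalar (`exists_scalar_of_skew`) and is removed by the
degree derivation. What is left kills the variables, after one more inner derivation also the torus
elements x_i x_{i'}, and then everything, by induction on the degree and comparison of torus weights
(`derModConsts_eq_zero`). Since p ≥ 5, the integers 2, 3 and 4 are invertible in these arguments.

Under the correspondence ad g with ∫ g = 0 gives the coboundaries, ad x^σ gives Σ, x_{i'}^{p-1} ∂_i
gives Ω_i and the degree derivation gives Δ. All but the last are automatically alternating;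
integration by parts produces the factor n + 4 as the obstruction for Δ (`topCoeff_degDer_mul_add`).
Independence modulo coboundaries is tested on pairs whose bracket is constant, where every
coboundary vanishes (`combination_eq_zero`). -/

namespace HamiltonianLie

/-! ### Monomials and coefficients in the truncated polynomial algebra. -/

section Monomials

variable (F : Type*) [Field F] (p m : ℕ)

/-- The monomial `x ^ a` of `A(n)`; it vanishes if some `a k` is at least `p`. -/
noncomputable def mono (a : Idx m → ℕ) : TruncPoly F p m :=
  truncMk F p m (MvPolynomial.monomial (Finsupp.equivFunOnFinite.symm a) 1)

/-- The coefficient of `x ^ a` as a linear form on `A(n)`, zero if some `a k` is at least `p`. -/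
noncomputable def coeffN (a : Idx m → ℕ) : TruncPoly F p m →ₗ[F] F :=
  if h : ∀ k, a k < p then coeffA F p m fun k => ⟨a k, h k⟩ else 0

variable {F p m}

theorem mono_mul (a b : Idx m → ℕ) : mono F p m a * mono F p m b = mono F p m (a + b) := by
  rw [mono, mono, mono, ← map_mul, MvPolynomial.monomial_mul, mul_one]
  congr 3
  ext k
  rfl

theorem mono_zero : mono F p m 0 = 1 := by
  rw [mono, ← map_one (truncMk F p m), ← MvPolynomial.C_1, ← MvPolynomial.monomial_zero']
  congr 3
  ext k
  rfl

theorem mono_eq_zero {a : Idx m → ℕ} {k : Idx m} (h : p ≤ a k) : mono F p m a = 0 := by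
  rw [mono, truncMk_eq_zero_iff]
  have h1 : (MvPolynomial.monomial (Finsupp.equivFunOnFinite.symm a) (1 : F)) =
      MvPolynomial.monomial (Finsupp.equivFunOnFinite.symm (a - Pi.single k p)) (1 : F) *
        (MvPolynomial.X k) ^ p := by
    rw [MvPolynomial.X_pow_eq_monomial, MvPolynomial.monomial_mul, mul_one]
    congr 2
    ext j
    by_cases hj : j = k
    · subst hj
      simp [h]
    · simp [hj]
  rw [h1]
  exact Ideal.mul_mem_left _ _ (Ideal.subset_span ⟨k, rfl⟩)

theorem coeffN_of_lt {a : Idx m → ℕ} (h : ∀ k, a k < p) (f : TruncPoly F p m) :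
    coeffN F p m a f = coeffA F p m (fun k => ⟨a k, h k⟩) f := by
  rw [coeffN, dif_pos h]

theorem coeffN_val (a : Idx m → Fin p) (f : TruncPoly F p m) :
    coeffN F p m (fun k => (a k : ℕ)) f = coeffA F p m a f := by
  rw [coeffN_of_lt fun k => (a k).isLt]

theorem coeffN_of_le {a : Idx m → ℕ} {k : Idx m} (h : p ≤ a k) (f : TruncPoly F p m) :
    coeffN F p m a f = 0 := by
  rw [coeffN, dif_neg, LinearMap.zero_apply]
  exact fun h' => absurd (h' k) (not_lt.2 h)

theorem coeffN_truncMk {a : Idx m → ℕ} (h : ∀ k, a k < p) (f : MvPolynomial (Idx m) F) :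
    coeffN F p m a (truncMk F p m f) =
      MvPolynomial.coeff (Finsupp.equivFunOnFinite.symm a) f := by
  rw [coeffN_of_lt h, coeffA_truncMk]

theorem coeffN_mono_self {a : Idx m → ℕ} (h : ∀ k, a k < p) :
    coeffN F p m a (mono F p m a) = 1 := by
  rw [mono, coeffN_truncMk h, MvPolynomial.coeff_monomial, if_pos rfl]

theorem coeffN_mono_ne {a b : Idx m → ℕ} (h : a ≠ b) :
    coeffN F p m b (mono F p m a) = 0 := by
  by_cases hb : ∀ k, b k < p
  · rw [mono, coeffN_truncMk hb, MvPolynomial.coeff_monomial, if_neg]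
    exact fun h' => h (Finsupp.equivFunOnFinite.symm.injective h')
  · rw [coeffN, dif_neg hb, LinearMap.zero_apply]

theorem mono_induction {P : TruncPoly F p m → Prop} (f : TruncPoly F p m)
    (hadd : ∀ f g, P f → P g → P (f + g)) (hsmul : ∀ (c : F) f, P f → P (c • f))
    (hmono : ∀ a : Idx m → ℕ, P (mono F p m a)) : P f := by
  obtain ⟨f, rfl⟩ := truncMk_surjective F p m f
  induction f using MvPolynomial.induction_on' with
  | monomial u a =>
    have h : truncMk F p m (MvPolynomial.monomial u a) = a • mono F p m u := by
      rw [mono, ← map_smul, MvPolynomial.smul_monomial, smul_eq_mul, mul_one]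
      congr 3
      ext k
      rfl
    rw [h]
    exact hsmul _ _ (hmono _)
  | add f g hf hg =>
    rw [map_add]
    exact hadd _ _ hf hg

/-- The expansion of an element of `A(n)` in the basis of monomials. -/
theorem eq_sum_mono (f : TruncPoly F p m) :
    f = ∑ a : Idx m → Fin p, coeffA F p m a f • mono F p m fun k => (a k : ℕ) := by
  induction f using mono_induction with
  | hadd f g hf hg =>
    conv_lhs => rw [hf, hg]
    simp only [map_add, add_smul, Finset.sum_add_distrib]
  | hsmul c f hf =>
    conv_lhs => rw [hf]
    simp only [map_smul, smul_assoc, Finset.smul_sum]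
  | hmono a =>
    by_cases h : ∀ k, a k < p
    · rw [Finset.sum_eq_single (fun k => ⟨a k, h k⟩ : Idx m → Fin p)]
      · rw [← coeffN_val, coeffN_mono_self h, one_smul]
      · intro b _ hb
        rw [← coeffN_val, coeffN_mono_ne, zero_smul]
        rintro rfl
        exact hb rfl
      · simp
    · push Not at h
      obtain ⟨k, hk⟩ := h
      rw [mono_eq_zero hk]
      simp

theorem ext_coeffN {f g : TruncPoly F p m}
    (h : ∀ a : Idx m → ℕ, (∀ k, a k < p) → coeffN F p m a f = coeffN F p m a g) : f = g := by
  rw [eq_sum_mono f, eq_sum_mono g]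
  refine Finset.sum_congr rfl fun a _ => ?_
  rw [← coeffN_val, ← coeffN_val, h _ fun k => (a k).isLt]

theorem coeffN_sum_mono (φ : (Idx m → Fin p) → F) (a : Idx m → Fin p) :
    coeffN F p m (fun k => (a k : ℕ)) (∑ b, φ b • mono F p m fun k => (b k : ℕ)) = φ a := by
  rw [map_sum, Finset.sum_eq_single a]
  · rw [map_smul, coeffN_mono_self fun k => (a k).isLt, smul_eq_mul, mul_one]
  · intro b _ hb
    rw [map_smul, coeffN_mono_ne, smul_zero]
    exact fun h => hb (funext fun k => Fin.ext (congrFun h k))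
  · simp

variable (F p m) in
/-- The element of `A(n)` with prescribed coefficients. -/
noncomputable def ofCoeff (φ : (Idx m → ℕ) → F) : TruncPoly F p m :=
  ∑ b : Idx m → Fin p, φ (fun k => (b k : ℕ)) • mono F p m fun k => (b k : ℕ)

theorem coeffN_ofCoeff (φ : (Idx m → ℕ) → F) {a : Idx m → ℕ} (h : ∀ k, a k < p) :
    coeffN F p m a (ofCoeff F p m φ) = φ a :=
  coeffN_sum_mono (fun b => φ fun k => (b k : ℕ)) fun k => ⟨a k, h k⟩

variable [CharP F p]

theorem partialD_mono (k : Idx m) (a : Idx m → ℕ) :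
    partialD F p m k (mono F p m a) = (a k : F) • mono F p m (a - Pi.single k 1) := by
  rw [mono, partialD_truncMk, MvPolynomial.pderiv_monomial, one_mul, mono, ← map_smul,
    MvPolynomial.smul_monomial, smul_eq_mul, mul_one]
  congr 3
  ext j
  by_cases hj : j = k
  · subst hj
    simp
  · simp [hj]

/-- No bound on a is needed: if a_k = p - 1, the factor a_k + 1 is zero in F, in agreement with the
default value of `coeffN` outside the box. -/
theorem coeffN_partialD (k : Idx m) (a : Idx m → ℕ) (f : TruncPoly F p m) :
    coeffN F p m a (partialD F p m k f) = ((a k : F) + 1) * coeffN F p m (a + Pi.single k 1) f := by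
  induction f using mono_induction with
  | hadd f g hf hg => simp only [map_add, hf, hg, mul_add]
  | hsmul c f hf => simp only [Derivation.map_smul, map_smul, hf, smul_eq_mul]; ring
  | hmono b =>
    rw [partialD_mono, map_smul, smul_eq_mul]
    by_cases hb : b = a + Pi.single k 1
    · subst hb
      rw [add_tsub_cancel_right]
      by_cases ha : ∀ j, a j < p
      · rw [coeffN_mono_self ha, mul_one]
        by_cases hk : a k + 1 < p
        · rw [coeffN_mono_self, mul_one]
          · simp
          · intro j
            by_cases hj : j = k
            · subst hj; simpa using hk
            · simpa [Pi.single_apply, hj] using ha j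
        · have h2 : a k + 1 = p := by have := ha k; omega
          have h3 : (a k : F) + 1 = 0 := by
            have := CharP.cast_eq_zero F p
            rw [← h2] at this
            exact_mod_cast this
          simp [h3]
      · push Not at ha
        obtain ⟨j, hj⟩ := ha
        rw [coeffN_of_le hj, coeffN_of_le (k := j), mul_zero, mul_zero]
        exact hj.trans (Nat.le_add_right _ _)
    · rw [coeffN_mono_ne hb, mul_zero]
      by_cases h0 : b k = 0
      · simp [h0]
      · rw [coeffN_mono_ne, mul_zero]
        rintro rfl
        apply hb
        ext j
        by_cases hj : j = k
        · subst hj; simp; omega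
        · simp [hj]

theorem bracket_mono (a b : Idx m → ℕ) :
    ⁅mono F p m a, mono F p m b⁆ = ∑ i : Fin m,
      ((a (.inl i) : F) * b (.inr i) - (a (.inr i) : F) * b (.inl i)) •
        mono F p m (a + b - Pi.single (.inl i) 1 - Pi.single (.inr i) 1) := by
  rw [bracket_def, hamD_apply]
  refine Finset.sum_congr rfl fun i _ => ?_
  simp only [partialD_mono, smul_mul_smul_comm, mono_mul, sub_smul]
  -- The truncated subtractions can be merged only if a_s and b_t are positive; otherwise the scalar
  -- in front is zero.
  have h : ∀ s t : Idx m, s ≠ t → ((a s : F) * b t) • mono F p m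
      (a - Pi.single s 1 + (b - Pi.single t 1)) = ((a s : F) * b t) • mono F p m
      (a + b - Pi.single s 1 - Pi.single t 1) := by
    intro s t hst
    by_cases ha : a s = 0
    · simp [ha]
    by_cases hb : b t = 0
    · simp [hb]
    congr 2
    ext j
    simp only [Pi.add_apply, Pi.sub_apply, Pi.single_apply]
    split_ifs with h1 h2 h2
    · exact absurd (h1.symm.trans h2) hst
    · subst h1; omega
    · subst h2; omega
    · omega
  rw [h _ _ (by simp), h _ _ (by simp), tsub_right_comm (b := Pi.single (Sum.inr i) 1)]

end Monomials

end HamiltonianLie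

/-! ### The Poisson calculus, closed 1-forms and the integral ∫. -/

namespace HamiltonianLie

theorem conj_conj {m : ℕ} (j : Idx m) : conj (conj j) = j := by cases j <;> rfl

theorem conj_ne {m : ℕ} (j : Idx m) : conj j ≠ j := by cases j <;> simp [conj]

theorem sgn_conj {m : ℕ} (j : Idx m) : sgn (conj j) = -sgn j := by cases j <;> rfl

theorem sgn_mul_self {m : ℕ} (j : Idx m) : sgn j * sgn j = 1 := by cases j <;> rfl

theorem sgn_cast_mul_self {m : ℕ} (R : Type*) [CommRing R] (j : Idx m) :
    (sgn j : R) * (sgn j : R) = 1 := by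
  rw [← Int.cast_mul, sgn_mul_self, Int.cast_one]

theorem conj_injective {m : ℕ} : Function.Injective (conj (m := m)) :=
  Function.LeftInverse.injective conj_conj

section Calculus

variable {F : Type*} [Field F] {p m : ℕ} [CharP F p]

theorem bracket_eq_sum (f g : TruncPoly F p m) :
    ⁅f, g⁆ = ∑ j : Idx m,
      (sgn j : TruncPoly F p m) * (partialD F p m j f * partialD F p m (conj j) g) := by
  rw [bracket_def, hamD_apply, Fintype.sum_sum_type, ← Finset.sum_add_distrib]
  refine Finset.sum_congr rfl fun i _ => ?_
  simp [sgn, conj, sub_eq_add_neg]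

theorem bracket_smul (c : F) (f g : TruncPoly F p m) : ⁅f, c • g⁆ = c • ⁅f, g⁆ :=
  (hamD F p m f).map_smul c g

theorem smul_bracket (c : F) (f g : TruncPoly F p m) : ⁅c • f, g⁆ = c • ⁅f, g⁆ := by
  rw [← lie_skew, bracket_smul, ← smul_neg, lie_skew]

theorem bracket_mul (f g h : TruncPoly F p m) : ⁅f, g * h⁆ = ⁅f, g⁆ * h + g * ⁅f, h⁆ := by
  simp only [bracket_def, Derivation.leibniz, smul_eq_mul]
  ring

theorem mul_bracket (f g h : TruncPoly F p m) : ⁅f * g, h⁆ = f * ⁅g, h⁆ + ⁅f, h⁆ * g := by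
  rw [← lie_skew, bracket_mul, ← lie_skew h g, ← lie_skew h f]
  ring

variable (F p m) in
/-- The variable `x_k` of `A(n)`. -/
noncomputable def var (k : Idx m) : TruncPoly F p m := mono F p m (Pi.single k 1)

theorem partialD_var (j k : Idx m) :
    partialD F p m j (var F p m k) = if j = k then 1 else 0 := by
  rw [var, partialD_mono]
  split_ifs with h
  · subst h
    simp [mono_zero]
  · simp [h]

theorem var_bracket (k : Idx m) (f : TruncPoly F p m) :
    ⁅var F p m k, f⁆ = (sgn k : F) • partialD F p m (conj k) f := by
  rw [bracket_eq_sum, Finset.sum_eq_single k]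
  · rw [partialD_var, if_pos rfl, one_mul, Algebra.smul_def, map_intCast]
  · intro j _ hj
    rw [partialD_var, if_neg hj]
    ring
  · simp

theorem partialD_eq_bracket (k : Idx m) (f : TruncPoly F p m) :
    partialD F p m k f = -(sgn k : F) • ⁅var F p m (conj k), f⁆ := by
  rw [var_bracket, conj_conj, sgn_conj, smul_smul, Int.cast_neg, neg_mul_neg,
    sgn_cast_mul_self, one_smul]

theorem bracket_var_var (j k : Idx m) :
    ⁅var F p m j, var F p m k⁆ = if k = conj j then (sgn j : F) • 1 else 0 := by
  rw [var_bracket, partialD_var]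
  split_ifs with h1 h2 h2
  · rfl
  · exact absurd h1.symm h2
  · exact absurd h2.symm h1
  · rw [smul_zero]

variable (F p m) in
/-- The line of the constants in `A(n)`. -/
noncomputable def consts : Submodule F (TruncPoly F p m) := Submodule.span F {1}

theorem one_mem_consts : (1 : TruncPoly F p m) ∈ consts F p m := Submodule.mem_span_singleton_self _

theorem smul_one_mem_consts (c : F) : c • (1 : TruncPoly F p m) ∈ consts F p m :=
  Submodule.smul_mem _ _ one_mem_consts

theorem lie_of_mem_consts {f : TruncPoly F p m} (hf : f ∈ consts F p m) (g : TruncPoly F p m) :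
    ⁅g, f⁆ = 0 := by
  obtain ⟨c, rfl⟩ := Submodule.mem_span_singleton.1 hf
  simp [bracket_def]

theorem lie_of_mem_consts_left {f : TruncPoly F p m} (hf : f ∈ consts F p m)
    (g : TruncPoly F p m) : ⁅f, g⁆ = 0 := by
  rw [← lie_skew, lie_of_mem_consts hf, neg_zero]

theorem coeffN_eq_zero_of_partialD {k : Idx m} {f : TruncPoly F p m}
    (hf : partialD F p m k f = 0) {a : Idx m → ℕ} (hk : a k ≠ 0) : coeffN F p m a f = 0 := by
  by_cases ha : p ≤ a k
  · exact coeffN_of_le ha f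
  have h1 := coeffN_partialD k (a - Pi.single k 1) f
  have h2 : a - Pi.single k 1 + Pi.single k 1 = a := by
    ext j
    by_cases hj : j = k
    · subst hj; simp; omega
    · simp [hj]
  have h3 : (((a - Pi.single k 1 : Idx m → ℕ) k : ℕ) : F) + 1 = (a k : F) := by
    simp only [Pi.sub_apply, Pi.single_eq_same]
    rw [← Nat.cast_add_one, Nat.sub_add_cancel (Nat.one_le_iff_ne_zero.2 hk)]
  rw [hf, map_zero, h2, h3] at h1
  refine (mul_eq_zero.1 h1.symm).resolve_left fun h => hk ?_
  exact Nat.eq_zero_of_dvd_of_lt ((CharP.cast_eq_zero_iff F p _).1 h) (not_le.1 ha)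

theorem mem_consts_of_coeffN {f : TruncPoly F p m}
    (hf : ∀ a : Idx m → ℕ, a ≠ 0 → coeffN F p m a f = 0) : f ∈ consts F p m := by
  refine Submodule.mem_span_singleton.2 ⟨coeffN F p m 0 f, ext_coeffN fun a ha => ?_⟩
  rw [map_smul, ← mono_zero, smul_eq_mul]
  by_cases h : a = 0
  · subst h
    rw [coeffN_mono_self ha, mul_one]
  · rw [coeffN_mono_ne (Ne.symm h), hf a h, mul_zero]

theorem mem_consts_of_partialD {f : TruncPoly F p m} (hf : ∀ k, partialD F p m k f = 0) :
    f ∈ consts F p m := by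
  refine mem_consts_of_coeffN fun a ha => ?_
  obtain ⟨k, hk⟩ := Function.ne_iff.1 ha
  exact coeffN_eq_zero_of_partialD (hf k) hk

theorem mem_consts_of_bracket {f : TruncPoly F p m}
    (hf : ∀ k, ⁅var F p m k, f⁆ = 0) : f ∈ consts F p m :=
  mem_consts_of_partialD fun k => by rw [partialD_eq_bracket, hf, smul_zero]

/-- A closed 1-form on `A(n)` is exact up to the forms `x_k ^ (p - 1) dx_k`. -/
theorem exists_potential {φ : Idx m → TruncPoly F p m}
    (hφ : ∀ j k, partialD F p m j (φ k) = partialD F p m k (φ j)) :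
    ∃ (g : TruncPoly F p m) (c : Idx m → F), ∀ k,
      φ k = partialD F p m k g + c k • mono F p m (Pi.single k (p - 1)) := by
  classical
  have hcast : ∀ a : ℕ, a ≠ 0 → a < p → (a : F) ≠ 0 := fun a h0 hlt h =>
    h0 (Nat.eq_zero_of_dvd_of_lt ((CharP.cast_eq_zero_iff F p _).1 h) hlt)
  have hadd : ∀ (a : Idx m → ℕ) (k : Idx m), a k ≠ 0 →
      a - Pi.single k 1 + Pi.single k 1 = a := by
    intro a k hk
    ext j
    by_cases hj : j = k
    · subst hj; simp; omega
    · simp [hj]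
  -- Closedness read off at the exponent a - ε_j - ε_k: the j-th and the k-th component prescribe
  -- the same coefficient of x^a for a potential.
  have hcompat : ∀ (a : Idx m → ℕ) (j k : Idx m), a j ≠ 0 → a k ≠ 0 →
      (a j : F) * coeffN F p m (a - Pi.single k 1) (φ k) =
        (a k : F) * coeffN F p m (a - Pi.single j 1) (φ j) := by
    intro a j k hj hk
    by_cases hjk : j = k
    · subst hjk; rfl
    have h := congrArg (coeffN F p m (a - Pi.single j 1 - Pi.single k 1)) (hφ j k)
    rw [coeffN_partialD, coeffN_partialD] at h
    rw [hadd (a - Pi.single j 1) k (by simpa [Ne.symm hjk] using hk), tsub_right_comm,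
      hadd (a - Pi.single k 1) j (by simpa [hjk] using hj)] at h
    have e1 : (((a - Pi.single k 1 - Pi.single j 1 : Idx m → ℕ) j : ℕ) : F) + 1 = a j := by
      simp only [Pi.sub_apply, Pi.single_eq_same, Pi.single_eq_of_ne hjk, tsub_zero]
      rw [← Nat.cast_add_one, Nat.sub_add_cancel (Nat.one_le_iff_ne_zero.2 hj)]
    have e2 : (((a - Pi.single k 1 - Pi.single j 1 : Idx m → ℕ) k : ℕ) : F) + 1 = a k := by
      simp only [Pi.sub_apply, Pi.single_eq_same, Pi.single_eq_of_ne (Ne.symm hjk), tsub_zero]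
      rw [← Nat.cast_add_one, Nat.sub_add_cancel (Nat.one_le_iff_ne_zero.2 hk)]
    rwa [e1, e2] at h
  -- The coefficient forced by one component with a_k ≠ 0; by `hcompat` the choice of that component
  -- does not matter.
  let G : (Idx m → ℕ) → F := fun a =>
    if h : ∃ k, a k ≠ 0 then coeffN F p m (a - Pi.single h.choose 1) (φ h.choose) /
      (a h.choose : F) else 0
  have hG : ∀ (a : Idx m → ℕ) (k : Idx m), (∀ j, a j < p) → a k ≠ 0 →
      (a k : F) * G a = coeffN F p m (a - Pi.single k 1) (φ k) := by
    intro a k ha hk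
    have h : ∃ k, a k ≠ 0 := ⟨k, hk⟩
    have h1 := hcompat a h.choose k h.choose_spec hk
    simp only [G]
    rw [dif_pos h, mul_div_assoc', ← h1, mul_div_cancel_left₀]
    exact hcast _ h.choose_spec (ha _)
  refine ⟨ofCoeff F p m G, fun k => coeffN F p m (Pi.single k (p - 1)) (φ k), fun k =>
    ext_coeffN fun a ha => ?_⟩
  rw [map_add, map_smul, coeffN_partialD, smul_eq_mul]
  beta_reduce
  by_cases hk : a k + 1 < p
  · have h1 : ∀ j, (a + Pi.single k 1 : Idx m → ℕ) j < p := by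
      intro j
      by_cases hj : j = k
      · subst hj; simpa using hk
      · simpa [hj] using ha j
    have h2 := hG (a + Pi.single k 1) k h1 (by simp)
    rw [add_tsub_cancel_right] at h2
    rw [coeffN_ofCoeff _ h1, ← h2, coeffN_mono_ne, mul_zero, add_zero]
    · simp
    · rintro rfl
      simp at hk
      omega
  -- No ∂_k-derivative contains x^a with a_k = p - 1. Closedness makes this coefficient of φ_k
  -- vanish as soon as another variable occurs in x^a, so only the pure power of x_k survives.
  · have hk' : a k = p - 1 := by have := ha k; omega
    have hk2 : p ≤ (a + Pi.single k 1 : Idx m → ℕ) k := by simpa using not_lt.1 hk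
    rw [coeffN_of_le hk2, mul_zero, zero_add]
    by_cases hs : a = Pi.single k (p - 1)
    · rw [← hs, coeffN_mono_self ha, mul_one]
    rw [coeffN_mono_ne (Ne.symm hs), mul_zero]
    obtain ⟨j, hj⟩ := Function.ne_iff.1 hs
    have hjk : j ≠ k := by
      rintro rfl
      simp [hk'] at hj
    rw [Pi.single_eq_of_ne hjk] at hj
    have h := congrArg (coeffN F p m (a - Pi.single j 1)) (hφ j k)
    rw [coeffN_partialD, coeffN_partialD, hadd a j hj,
      coeffN_of_le (k := k) (a := a - Pi.single j 1 + Pi.single k 1), mul_zero] at h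
    · refine (mul_eq_zero.1 h).resolve_left ?_
      simp only [Pi.sub_apply, Pi.single_eq_same]
      rw [← Nat.cast_add_one, Nat.sub_add_cancel (Nat.one_le_iff_ne_zero.2 hj)]
      exact hcast _ hj (ha j)
    · simp only [Pi.add_apply, Pi.sub_apply, Pi.single_eq_same, Pi.single_eq_of_ne (Ne.symm hjk)]
      omega

variable (F p m) in
/-- The coefficient of `x_1 ^ (p - 1) ⋯ x_n ^ (p - 1)`. -/
noncomputable def topCoeff : TruncPoly F p m →ₗ[F] F := coeffN F p m fun _ => p - 1

theorem topCoeff_partialD (k : Idx m) (f : TruncPoly F p m) :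
    topCoeff F p m (partialD F p m k f) = 0 := by
  rw [topCoeff, coeffN_partialD, coeffN_of_le (k := k), mul_zero]
  simp
  omega

/-- The bracket is a divergence because partial derivatives commute, and ∫ kills every partial
derivative. -/
theorem topCoeff_bracket (f g : TruncPoly F p m) : topCoeff F p m ⁅f, g⁆ = 0 := by
  rw [bracket_def, hamD_apply, map_sum]
  refine Finset.sum_eq_zero fun i _ => ?_
  have h : partialD F p m (.inl i) f * partialD F p m (.inr i) g -
      partialD F p m (.inr i) f * partialD F p m (.inl i) g =
      partialD F p m (.inr i) (partialD F p m (.inl i) f * g) -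
      partialD F p m (.inl i) (partialD F p m (.inr i) f * g) := by
    simp only [Derivation.leibniz, smul_eq_mul]
    rw [partialD_comm F p m (.inr i) (.inl i)]
    ring
  rw [h, map_sub, topCoeff_partialD, topCoeff_partialD, sub_zero]

/-- Integrate the derivation ad g applied to fh. This invariance turns the cocycle identity into the
Leibniz rule. -/
theorem topCoeff_bracket_mul (f g h : TruncPoly F p m) :
    topCoeff F p m (⁅f, g⁆ * h) = topCoeff F p m (f * ⁅g, h⁆) := by
  have h1 := topCoeff_bracket g (f * h)
  rw [bracket_mul, map_add, ← lie_skew g f, neg_mul, map_neg] at h1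
  exact neg_add_eq_zero.1 h1

theorem topCoeff_mul_mono (f : TruncPoly F p m) {a : Idx m → ℕ} (ha : ∀ k, a k < p) :
    topCoeff F p m (f * mono F p m fun k => p - 1 - a k) = coeffN F p m a f := by
  induction f using mono_induction with
  | hadd f g hf hg => simp only [add_mul, map_add, hf, hg]
  | hsmul c f hf => simp only [smul_mul_assoc, map_smul, hf]
  | hmono b =>
    rw [mono_mul, topCoeff]
    by_cases h : b = a
    · subst h
      rw [coeffN_mono_self ha]
      have h1 : (b + fun k => p - 1 - b k) = fun _ => p - 1 := by
        ext k
        have := ha k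
        simp
        omega
      rw [h1, coeffN_mono_self]
      exact fun k => by have := ha k; omega
    · rw [coeffN_mono_ne h, coeffN_mono_ne]
      intro h1
      apply h
      ext k
      have h2 := congrFun h1 k
      have := ha k
      simp at h2
      omega

/-- The form `∫ f g` pairs the hyperplane `∫ f = 0` with itself with radical the constants. -/
theorem mem_consts_of_topCoeff_mul {f : TruncPoly F p m}
    (hf : ∀ g, topCoeff F p m g = 0 → topCoeff F p m (f * g) = 0) : f ∈ consts F p m := by
  refine mem_consts_of_coeffN fun a ha => ?_
  by_cases hlt : ∀ k, a k < p
  · rw [← topCoeff_mul_mono f hlt]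
    -- The complementary monomial that extracts the coefficient of x^a lies in the hyperplane
    -- precisely because a ≠ 0.
    refine hf _ (coeffN_mono_ne fun h => ha ?_)
    ext k
    have h1 := congrFun h k
    have := hlt k
    simp only [Pi.zero_apply] at h1 ⊢
    omega
  · push Not at hlt
    obtain ⟨k, hk⟩ := hlt
    exact coeffN_of_le hk f

end Calculus

end HamiltonianLie

/-! ### The derivations that will span: inner, power and degree derivations. -/

namespace HamiltonianLie

section Derivations

variable {F : Type*} [Field F] {p m : ℕ} [CharP F p]

variable (F p m) in
/-- The linear maps of `A(n)` that induce derivations from `H(n)` to `A(n) / ⟨1⟩`. -/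
noncomputable def derModConsts : Submodule F (TruncPoly F p m →ₗ[F] TruncPoly F p m) where
  carrier := {D | D 1 ∈ consts F p m ∧ ∀ f g, topCoeff F p m f = 0 → topCoeff F p m g = 0 →
    D ⁅f, g⁆ - (⁅D f, g⁆ + ⁅f, D g⁆) ∈ consts F p m}
  add_mem' := by
    rintro D D' ⟨h1, h2⟩ ⟨h1', h2'⟩
    refine ⟨add_mem h1 h1', fun f g hf hg => ?_⟩
    have h := add_mem (h2 f g hf hg) (h2' f g hf hg)
    simp only [LinearMap.add_apply, add_lie, lie_add]
    convert h using 1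
    abel
  zero_mem' := by simp
  smul_mem' := by
    rintro c D ⟨h1, h2⟩
    refine ⟨Submodule.smul_mem _ _ h1, fun f g hf hg => ?_⟩
    have h := Submodule.smul_mem _ c (h2 f g hf hg)
    simpa only [LinearMap.smul_apply, smul_bracket, bracket_smul, smul_add, smul_sub] using h

theorem derModConsts_lie {D : TruncPoly F p m →ₗ[F] TruncPoly F p m}
    (hD : D ∈ derModConsts F p m) {f g : TruncPoly F p m} (hf : topCoeff F p m f = 0)
    (hg : topCoeff F p m g = 0) : D ⁅f, g⁆ - (⁅D f, g⁆ + ⁅f, D g⁆) ∈ consts F p m :=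
  hD.2 f g hf hg

variable (F p m) in
/-- The inner derivation `f ↦ ⁅g, f⁆`. -/
noncomputable def adL (g : TruncPoly F p m) : TruncPoly F p m →ₗ[F] TruncPoly F p m :=
  (hamD F p m g).toLinearMap

theorem adL_apply (g f : TruncPoly F p m) : adL F p m g f = ⁅g, f⁆ := rfl

theorem adL_lie (g f f' : TruncPoly F p m) :
    adL F p m g ⁅f, f'⁆ = ⁅adL F p m g f, f'⁆ + ⁅f, adL F p m g f'⁆ :=
  leibniz_lie g f f'

theorem adL_mem (g : TruncPoly F p m) : adL F p m g ∈ derModConsts F p m := by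
  refine ⟨?_, fun f f' _ _ => ?_⟩
  · rw [adL_apply, lie_of_mem_consts one_mem_consts]
    exact zero_mem _
  · rw [adL_lie, sub_self]
    exact zero_mem _

variable (F p m) in
/-- The derivation `x_{i'} ^ (p - 1) ∂ / ∂x_i`. -/
noncomputable def powDer (i : Idx m) : TruncPoly F p m →ₗ[F] TruncPoly F p m :=
  (mono F p m (Pi.single (conj i) (p - 1)) • partialD F p m i).toLinearMap

theorem powDer_apply (i : Idx m) (f : TruncPoly F p m) :
    powDer F p m i f = mono F p m (Pi.single (conj i) (p - 1)) * partialD F p m i f := rfl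

theorem partialD_mono_single {j k : Idx m} (h : j ≠ k) (a : ℕ) :
    partialD F p m j (mono F p m (Pi.single k a)) = 0 := by
  rw [partialD_mono, Pi.single_eq_of_ne h, Nat.cast_zero, zero_smul]

/-- Up to sign this is formally the inner derivation of x_{i'}^p / p. Since h depends on x_{i'}
alone, the two terms in which h is differentiated cancel. -/
theorem powDer_lie (i : Idx m) (f g : TruncPoly F p m) :
    powDer F p m i ⁅f, g⁆ = ⁅powDer F p m i f, g⁆ + ⁅f, powDer F p m i g⁆ := by
  simp only [powDer_apply]
  set h := mono F p m (Pi.single (conj i) (p - 1)) with hh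
  have hD : ∀ j, j ≠ conj i → partialD F p m j h = 0 := fun j hj => partialD_mono_single hj _
  have e1 : ⁅h, g⁆ = -(sgn i : TruncPoly F p m) * (partialD F p m (conj i) h * partialD F p m i g) := by
    rw [bracket_eq_sum, Finset.sum_eq_single (conj i)]
    · rw [conj_conj, sgn_conj, Int.cast_neg]
    · intro j _ hj
      rw [hD j hj]
      ring
    · simp
  have e2 : ⁅f, h⁆ = (sgn i : TruncPoly F p m) * (partialD F p m i f * partialD F p m (conj i) h) := by
    rw [bracket_eq_sum, Finset.sum_eq_single i]
    · intro j _ hj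
      rw [hD _ fun h => hj (conj_injective h)]
      ring
    · simp
  have e3 : partialD F p m i ⁅f, g⁆ = ⁅partialD F p m i f, g⁆ + ⁅f, partialD F p m i g⁆ := by
    simp only [bracket_def, hamD_apply, map_sum, ← Finset.sum_add_distrib, map_sub,
      Derivation.leibniz, smul_eq_mul, partialD_comm F p m i]
    exact Finset.sum_congr rfl fun _ _ => by ring
  rw [mul_bracket, bracket_mul, e1, e2, e3]
  ring

theorem powDer_mem (i : Idx m) : powDer F p m i ∈ derModConsts F p m := by
  refine ⟨?_, fun f f' _ _ => ?_⟩
  · rw [powDer_apply, Derivation.map_one_eq_zero, mul_zero]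
    exact zero_mem _
  · rw [powDer_lie, sub_self]
    exact zero_mem _

variable (F p m) in
/-- The Euler derivation `∑ x_j ∂ / ∂x_j`. -/
noncomputable def euler : TruncPoly F p m →ₗ[F] TruncPoly F p m :=
  ∑ j, (var F p m j • partialD F p m j).toLinearMap

theorem euler_apply (f : TruncPoly F p m) :
    euler F p m f = ∑ j, var F p m j * partialD F p m j f := by
  rw [euler, LinearMap.sum_apply]
  rfl

theorem euler_mul (f g : TruncPoly F p m) :
    euler F p m (f * g) = euler F p m f * g + f * euler F p m g := by
  simp only [euler_apply, Derivation.leibniz, smul_eq_mul, Finset.sum_mul, Finset.mul_sum,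
    ← Finset.sum_add_distrib]
  exact Finset.sum_congr rfl fun _ _ => by ring

theorem euler_partialD (k : Idx m) (f : TruncPoly F p m) :
    partialD F p m k (euler F p m f) = euler F p m (partialD F p m k f) + partialD F p m k f := by
  rw [euler_apply, map_sum, euler_apply]
  simp only [Derivation.leibniz, smul_eq_mul, partialD_var, partialD_comm F p m k]
  rw [Finset.sum_add_distrib]
  simp

/-- A bracket lowers the polynomial degree by two; this is the reason for the shift in `degDer`. -/
theorem euler_lie (f g : TruncPoly F p m) :
    euler F p m ⁅f, g⁆ + (2 : F) • ⁅f, g⁆ = ⁅euler F p m f, g⁆ + ⁅f, euler F p m g⁆ := by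
  simp only [bracket_def, hamD_apply, map_sum, map_sub, euler_mul, euler_partialD,
    Finset.smul_sum, ← Finset.sum_add_distrib, two_smul]
  exact Finset.sum_congr rfl fun _ _ => by ring

theorem euler_mono (a : Idx m → ℕ) :
    euler F p m (mono F p m a) = ((∑ j, a j : ℕ) : F) • mono F p m a := by
  rw [euler_apply, Nat.cast_sum, Finset.sum_smul]
  refine Finset.sum_congr rfl fun j _ => ?_
  rw [partialD_mono, mul_smul_comm, var, mono_mul]
  by_cases h : a j = 0
  · simp [h]
  · congr 2
    ext k
    by_cases hk : k = j
    · subst hk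
      simp
      omega
    · simp [hk]

variable (F p m) in
/-- The degree derivation `x ^ a ↦ (|a| - 2) x ^ a`. -/
noncomputable def degDer : TruncPoly F p m →ₗ[F] TruncPoly F p m :=
  euler F p m - (2 : F) • LinearMap.id

theorem degDer_apply (f : TruncPoly F p m) :
    degDer F p m f = euler F p m f - (2 : F) • f := rfl

theorem degDer_mono (a : Idx m → ℕ) :
    degDer F p m (mono F p m a) = (((∑ j, a j : ℕ) : F) - 2) • mono F p m a := by
  rw [degDer_apply, euler_mono, sub_smul]

theorem degDer_lie (f g : TruncPoly F p m) :
    degDer F p m ⁅f, g⁆ = ⁅degDer F p m f, g⁆ + ⁅f, degDer F p m g⁆ := by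
  have h := euler_lie f g
  rw [← eq_sub_iff_add_eq] at h
  rw [degDer_apply, degDer_apply, degDer_apply, h, sub_lie, lie_sub, smul_bracket, bracket_smul]
  abel

theorem degDer_mem : degDer F p m ∈ derModConsts F p m := by
  refine ⟨?_, fun f f' _ _ => ?_⟩
  · rw [← mono_zero, degDer_mono, mono_zero]
    exact smul_one_mem_consts _
  · rw [degDer_lie, sub_self]
    exact zero_mem _

end Derivations

end HamiltonianLie

/-! ### Normalizing a derivation on the variables. -/

namespace HamiltonianLie

section Normalization

variable {F : Type*} [Field F] {p m : ℕ}

theorem smul_one_inj (hp : 5 ≤ p) {c d : F} (h : c • (1 : TruncPoly F p m) = d • 1) : c = d := by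
  have h1 := congrArg (coeffN F p m 0) h
  rw [map_smul, map_smul, ← mono_zero,
    coeffN_mono_self (fun _ => by simp only [Pi.zero_apply]; omega), smul_eq_mul, mul_one,
    smul_eq_mul, mul_one] at h1
  exact h1

variable [CharP F p]

theorem topCoeff_mono_of_ne {a : Idx m → ℕ} {k : Idx m} (h : a k ≠ p - 1) :
    topCoeff F p m (mono F p m a) = 0 :=
  coeffN_mono_ne fun h' => h (congrFun h' k)

theorem topCoeff_var (hp : 5 ≤ p) (k : Idx m) : topCoeff F p m (var F p m k) = 0 :=
  topCoeff_mono_of_ne (k := k) (by rw [Pi.single_eq_same]; omega)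

theorem topCoeff_var_mul_var (hp : 5 ≤ p) (j k : Idx m) :
    topCoeff F p m (var F p m j * var F p m k) = 0 := by
  rw [var, var, mono_mul]
  refine topCoeff_mono_of_ne (k := k) ?_
  simp only [Pi.add_apply, Pi.single_apply]
  split_ifs <;> omega

theorem eq_smul_one_of_mem_consts (hp : 5 ≤ p) {f : TruncPoly F p m} (hf : f ∈ consts F p m) :
    f = coeffN F p m 0 f • 1 := by
  obtain ⟨c, rfl⟩ := Submodule.mem_span_singleton.1 hf
  rw [map_smul, ← mono_zero, coeffN_mono_self (fun _ => by simp only [Pi.zero_apply]; omega),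
    smul_eq_mul, mul_one]

theorem natCast_ne_zero {a : ℕ} (h0 : a ≠ 0) (hlt : a < p) : (a : F) ≠ 0 := fun h =>
  h0 (Nat.eq_zero_of_dvd_of_lt ((CharP.cast_eq_zero_iff F p _).1 h) hlt)

theorem two_ne_zero_of_five_le (hp : 5 ≤ p) : (2 : F) ≠ 0 :=
  natCast_ne_zero (a := 2) (p := p) (by omega) (by omega)

theorem var_bracket_var_bracket_comm (i j : Idx m) (f : TruncPoly F p m) :
    ⁅var F p m i, ⁅var F p m j, f⁆⁆ = ⁅var F p m j, ⁅var F p m i, f⁆⁆ := by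
  simp only [var_bracket, Derivation.map_smul]
  rw [smul_comm, partialD_comm]

variable (F) in
/-- The value of the constant `⁅x_j, x_k⁆`. -/
def symp (j k : Idx m) : F := if k = conj j then (sgn j : F) else 0

theorem bracket_var_var' (j k : Idx m) :
    ⁅var F p m j, var F p m k⁆ = symp F j k • 1 := by
  rw [bracket_var_var, symp]
  split_ifs
  · rfl
  · rw [zero_smul]

theorem powDer_var (i k : Idx m) : powDer F p m i (var F p m k) =
    if i = k then mono F p m (Pi.single (conj k) (p - 1)) else 0 := by
  rw [powDer_apply, partialD_var]
  split_ifs with h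
  · rw [h, mul_one]
  · rw [mul_zero]

/-- Modulo inner derivations and the `powDer i`, a derivation is linear and skew on the span of the
variables. -/
theorem exists_sub_linear (hp : 5 ≤ p) {D : TruncPoly F p m →ₗ[F] TruncPoly F p m}
    (hD : D ∈ derModConsts F p m) :
    ∃ (g : TruncPoly F p m) (c : Idx m → F) (b : Idx m → Idx m → F),
      (∀ k a, ⁅var F p m k, (D - adL F p m g - ∑ i, c i • powDer F p m i) (var F p m a)⁆ =
        b k a • 1) ∧ ∀ k a, b k a = -b a k := by
  -- The signs are chosen so that D = ad g on the variables would mean φ = -dg. The choice of sign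
  -- of g is made when the potential is inserted below.
  let φ : Idx m → TruncPoly F p m := fun k => (sgn k : F) • D (var F p m (conj k))
  let κ : Idx m → Idx m → F := fun j k =>
    coeffN F p m 0 (partialD F p m j (φ k) - partialD F p m k (φ j))
  have hκ : ∀ j k, partialD F p m j (φ k) - partialD F p m k (φ j) = κ j k • 1 := by
    intro j k
    refine eq_smul_one_of_mem_consts hp ?_
    -- Brackets of variables are constants, which D sends to constants; the Leibniz rule then makes
    -- dφ a constant 2-form.
    have h := derModConsts_lie hD (topCoeff_var hp (conj j)) (topCoeff_var hp (conj k))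
    rw [bracket_var_var', map_smul] at h
    have h1 := sub_mem (Submodule.smul_mem _ (symp F (conj j) (conj k)) hD.1) h
    rw [sub_sub_cancel, ← lie_skew, var_bracket, var_bracket, conj_conj, conj_conj] at h1
    have h2 := Submodule.smul_mem _ (-(sgn j * sgn k : F)) h1
    convert h2 using 1
    simp only [φ, Derivation.map_smul, sgn_conj, Int.cast_neg, neg_smul, smul_add, smul_neg,
      neg_neg, smul_smul, neg_mul]
    have e1 : (sgn j : F) * sgn k * sgn k = sgn j := by rw [mul_assoc, sgn_cast_mul_self, mul_one]
    have e2 : (sgn j : F) * sgn k * sgn j = sgn k := by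
      rw [mul_right_comm, sgn_cast_mul_self, one_mul]
    rw [e1, e2]
    abel
  have hanti : ∀ j k, κ j k = -κ k j := by
    intro j k
    simp only [κ, ← map_neg, neg_sub]
  have h2 : (2 : F) ≠ 0 := two_ne_zero_of_five_le hp
  -- A linear 1-form with the same differential κ as φ; the half compensates the two equal
  -- contributions of the skew matrix κ.
  let lin : Idx m → TruncPoly F p m := fun k => ∑ j, (κ j k / 2) • var F p m j
  have hlin : ∀ l k, partialD F p m l (lin k) = (κ l k / 2) • 1 := by
    intro l k
    rw [map_sum, Finset.sum_eq_single l]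
    · rw [Derivation.map_smul, partialD_var, if_pos rfl]
    · intro j _ hj
      rw [Derivation.map_smul, partialD_var, if_neg hj.symm, smul_zero]
    · simp
  obtain ⟨g, c, hg⟩ := exists_potential (φ := fun k => φ k - lin k) fun j k => by
    rw [map_sub, map_sub, hlin, hlin, ← sub_eq_zero, sub_sub_sub_comm, hκ, ← sub_smul, ← sub_smul,
      hanti k j]
    have : κ j k - (κ j k / 2 - -κ j k / 2) = 0 := by field_simp; ring
    rw [this, zero_smul]
  refine ⟨g, fun i => -(sgn i : F) * c (conj i),
    fun k a => -(sgn a * sgn k : F) * (κ (conj k) (conj a) / 2), fun k a => ?_, fun k a => ?_⟩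
  · have e : (D - adL F p m g - ∑ i, (-(sgn i : F) * c (conj i)) • powDer F p m i) (var F p m a) =
        -(sgn a : F) • lin (conj a) := by
      have e1 : (∑ i, (-(sgn i : F) * c (conj i)) • powDer F p m i) (var F p m a) =
          (-(sgn a : F) * c (conj a)) • mono F p m (Pi.single (conj a) (p - 1)) := by
        rw [LinearMap.sum_apply, Finset.sum_eq_single a]
        · rw [LinearMap.smul_apply, powDer_var, if_pos rfl]
        · intro j _ hj
          rw [LinearMap.smul_apply, powDer_var, if_neg hj, smul_zero]
        · simp
      have e2 : D (var F p m a) = -(sgn a : F) • φ (conj a) := by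
        simp only [φ, conj_conj, sgn_conj, Int.cast_neg, smul_smul, neg_mul_neg,
          sgn_cast_mul_self, one_smul]
      have e3 := hg (conj a)
      rw [sub_eq_iff_eq_add] at e3
      rw [LinearMap.sub_apply, LinearMap.sub_apply, e1, e2, e3, adL_apply, ← lie_skew, var_bracket]
      simp only [smul_add, neg_smul, neg_mul, mul_smul]
      abel
    rw [e, bracket_smul, var_bracket, hlin, smul_smul, smul_smul]
    congr 1
    ring
  · simp only []
    rw [hanti (conj k) (conj a)]
    ring

/-- A derivation that is linear and skew on the span of the variables is scalar there. -/
theorem exists_scalar_of_skew (hp : 5 ≤ p) {D : TruncPoly F p m →ₗ[F] TruncPoly F p m}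
    (hD : D ∈ derModConsts F p m) {b : Idx m → Idx m → F}
    (hb : ∀ k a, ⁅var F p m k, D (var F p m a)⁆ = b k a • 1) (hanti : ∀ k a, b k a = -b a k) :
    ∃ κ : F, ∀ k, D (var F p m k) - κ • var F p m k ∈ consts F p m := by
  have h2 : (2 : F) ≠ 0 := two_ne_zero_of_five_le hp
  have hb' : ∀ k a, ⁅D (var F p m k), var F p m a⁆ = b k a • 1 := by
    intro k a
    rw [← lie_skew, hb, hanti k a, neg_smul]
  -- D is tested on the quadratic monomial x_u x_v. The actions of x_z and x_w commute, so the
  -- resulting scalar is symmetric in z and w; its formula is antisymmetric, hence it vanishes after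
  -- division by 2.
  have hQ : ∀ u v z w : Idx m, symp F w u * b z v + symp F w v * b z u - b w u * symp F z v -
      b w v * symp F z u = 0 := by
    intro u v
    have key : ∀ z w : Idx m,
        ⁅var F p m z, ⁅var F p m w, D (var F p m u * var F p m v)⁆⁆ =
          (symp F w u * b z v + symp F w v * b z u - b w u * symp F z v -
            b w v * symp F z u) • 1 := by
      intro z w
      have h := lie_of_mem_consts (derModConsts_lie hD (topCoeff_var hp w)
        (topCoeff_var_mul_var hp u v)) (var F p m z)
      rw [bracket_mul, bracket_mul, hb', hb', bracket_var_var', bracket_var_var'] at h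
      simp only [smul_mul_assoc, mul_smul_comm, one_mul, mul_one, map_add, map_smul, lie_sub,
        lie_add, bracket_smul, hb, bracket_var_var', smul_smul, ← add_smul] at h
      rw [← sub_sub, sub_eq_zero, ← sub_smul] at h
      rw [← h]
      congr 1
      ring
    intro z w
    have h := (key z w).symm.trans ((var_bracket_var_bracket_comm z w _).trans (key w z))
    have h := smul_one_inj hp h
    have h' : 2 * (symp F w u * b z v + symp F w v * b z u - b w u * symp F z v -
      b w v * symp F z u) = 0 := by linear_combination h
    exact (mul_eq_zero.1 h').resolve_left h2
  have hs : ∀ a : Idx m, symp F (conj a) a = -(sgn a : F) := by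
    intro a
    rw [symp, conj_conj, if_pos rfl, sgn_conj, Int.cast_neg]
  have hs0 : ∀ z a : Idx m, z ≠ conj a → symp F z a = 0 := by
    intro z a h
    rw [symp, if_neg]
    rintro rfl
    exact h (conj_conj z).symm
  have hsq : ∀ a : Idx m, (sgn a : F) * sgn a = 1 := sgn_cast_mul_self F
  -- The square x_a^2 shows that b is supported on conjugate pairs; below, x_a x_c shows that the
  -- ratio of b to the symplectic form is the same on all pairs.
  have hdiag : ∀ z a : Idx m, z ≠ conj a → b z a = 0 := by
    intro z a h
    have h1 := hQ a a z (conj a)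
    rw [hs, hs0 z a h] at h1
    have h3 : 2 * b z a = 0 := by linear_combination (-(sgn a : F)) * h1 - 2 * b z a * hsq a
    exact (mul_eq_zero.1 h3).resolve_left h2
  have hconst : ∀ a c : Idx m, (sgn a : F) * b (conj a) a = sgn c * b (conj c) c := by
    intro a c
    by_cases h : a = c
    · rw [h]
    have h' : conj a ≠ conj c := fun h' => h (conj_injective h')
    have h1 := hQ a c (conj c) (conj a)
    rw [hs, hs, hs0 _ _ h', hdiag _ _ h', hdiag _ _ h'.symm] at h1
    linear_combination (sgn a * sgn c : F) * h1 + sgn c * b (conj c) c * hsq a -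
      sgn a * b (conj a) a * hsq c
  rcases isEmpty_or_nonempty (Idx m) with _ | ⟨⟨a₀⟩⟩
  · exact ⟨0, fun k => isEmptyElim k⟩
  refine ⟨-(sgn a₀ * b (conj a₀) a₀ : F), fun k => mem_consts_of_bracket fun z => ?_⟩
  rw [lie_sub, hb, bracket_smul, bracket_var_var', smul_smul, ← sub_smul]
  by_cases hz : z = conj k
  · subst hz
    rw [hs, hconst a₀ k]
    have : b (conj k) k - -((sgn k : F) * b (conj k) k) * -(sgn k : F) = 0 := by
      linear_combination -b (conj k) k * hsq k
    rw [this, zero_smul]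
  · rw [hs0 _ _ hz, hdiag _ _ hz, mul_zero, sub_zero, zero_smul]

end Normalization

end HamiltonianLie

/-! ### Derivations that kill the variables: torus weights and induction on the degree. -/

namespace HamiltonianLie

section Vanishing

variable {F : Type*} [Field F] {p m : ℕ}

variable (F p m) in
/-- The element `x_i x_{i'}` of the torus of `H(n)`. -/
noncomputable def torus (i : Idx m) : TruncPoly F p m := var F p m i * var F p m (conj i)

theorem torus_conj (i : Idx m) : torus F p m (conj i) = torus F p m i := by
  rw [torus, torus, conj_conj, mul_comm]

variable [CharP F p]

theorem symp_conj (k : Idx m) : symp F k (conj k) = sgn k := if_pos rfl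

theorem symp_of_ne {j k : Idx m} (h : k ≠ conj j) : symp F j k = 0 := if_neg h

theorem sgn_cast_ne_zero (k : Idx m) : (sgn k : F) ≠ 0 := fun h => by
  have := sgn_cast_mul_self F k
  rw [h, mul_zero] at this
  exact zero_ne_one this

theorem var_mul_partialD_mono (j : Idx m) (a : Idx m → ℕ) :
    var F p m j * partialD F p m j (mono F p m a) = (a j : F) • mono F p m a := by
  rw [partialD_mono, mul_smul_comm, var, mono_mul]
  by_cases h : a j = 0
  · simp [h]
  · congr 2
    ext k
    by_cases hk : k = j
    · subst hk
      simp
      omega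
    · simp [hk]

theorem topCoeff_torus (hp : 5 ≤ p) (i : Idx m) : topCoeff F p m (torus F p m i) = 0 :=
  topCoeff_var_mul_var hp _ _

theorem var_lie_torus (k i : Idx m) : ⁅var F p m k, torus F p m i⁆ =
    symp F k i • var F p m (conj i) + symp F k (conj i) • var F p m i := by
  rw [torus, bracket_mul, bracket_var_var', bracket_var_var', smul_mul_assoc, one_mul,
    mul_smul_comm, mul_one]

theorem torus_lie_mono (i : Idx m) (a : Idx m → ℕ) : ⁅torus F p m i, mono F p m a⁆ =
    ((sgn i : F) * (a (conj i) - a i)) • mono F p m a := by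
  rw [torus, mul_bracket, var_bracket, var_bracket, conj_conj, sgn_conj, mul_smul_comm,
    var_mul_partialD_mono, smul_mul_assoc, mul_comm (partialD F p m (conj i) _),
    var_mul_partialD_mono, smul_smul, smul_smul, ← add_smul]
  congr 1
  push_cast
  ring

theorem torus_lie_torus (i j : Idx m) : ⁅torus F p m i, torus F p m j⁆ = 0 := by
  have h : torus F p m j = mono F p m (Pi.single j 1 + Pi.single (conj j) 1) := by
    rw [torus, var, var, mono_mul]
  rw [h, torus_lie_mono]
  have : ((Pi.single j 1 + Pi.single (conj j) 1 : Idx m → ℕ) (conj i)) =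
      (Pi.single j 1 + Pi.single (conj j) 1 : Idx m → ℕ) i := by
    simp only [Pi.add_apply, Pi.single_apply, conj_injective.eq_iff]
    have h1 : conj i = j ↔ i = conj j := ⟨fun h => by rw [← h, conj_conj],
      fun h => by rw [h, conj_conj]⟩
    simp only [h1]
    exact add_comm _ _
  rw [this, sub_self, mul_zero, zero_smul]

theorem torus_lie_linear {v : TruncPoly F p m} {t : Idx m → F}
    (ht : ∀ k, ⁅var F p m k, v⁆ = t k • 1) (i : Idx m) : ⁅torus F p m i, v⁆ =
      t (conj i) • var F p m i + t i • var F p m (conj i) := by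
  rw [torus, mul_bracket, ht, ht, smul_mul_assoc, one_mul, mul_smul_comm, mul_one]

theorem var_lie_torus_lie_linear {v : TruncPoly F p m} {t : Idx m → F}
    (ht : ∀ k, ⁅var F p m k, v⁆ = t k • 1) (k i : Idx m) : ⁅var F p m k, ⁅torus F p m i, v⁆⁆ =
      (t (conj i) * symp F k i + t i * symp F k (conj i)) • 1 := by
  rw [torus_lie_linear ht, lie_add, bracket_smul, bracket_smul, bracket_var_var',
    bracket_var_var', smul_smul, smul_smul, add_smul]

variable {D : TruncPoly F p m →ₗ[F] TruncPoly F p m}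

theorem derModConsts_lie_mem (hD : D ∈ derModConsts F p m) {f g : TruncPoly F p m}
    (hf : topCoeff F p m f = 0) (hg : topCoeff F p m g = 0) (hDf : D f ∈ consts F p m) :
    D ⁅f, g⁆ - ⁅f, D g⁆ ∈ consts F p m := by
  have h := derModConsts_lie hD hf hg
  rwa [lie_of_mem_consts_left hDf, zero_add] at h

/-- A derivation that kills the variables kills the torus after subtraction of the inner derivation
of a linear form. -/
theorem exists_sub_adL_torus (hp : 5 ≤ p) (hD : D ∈ derModConsts F p m)
    (hV : ∀ k, D (var F p m k) ∈ consts F p m) :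
    ∃ w : TruncPoly F p m, (∀ k, (D - adL F p m w) (var F p m k) ∈ consts F p m) ∧
      ∀ j, (D - adL F p m w) (torus F p m j) ∈ consts F p m := by
  -- The bracket of x_k with x_i x_{i'} is a linear form, which D sends to constants. So D(x_i
  -- x_{i'}) has constant partial derivatives.
  have h1 : ∀ k i, ∃ t : F, t • (1 : TruncPoly F p m) = ⁅var F p m k, D (torus F p m i)⁆ := by
    intro k i
    refine Submodule.mem_span_singleton.1 ?_
    have h := derModConsts_lie_mem hD (topCoeff_var hp k) (topCoeff_torus hp i) (hV k)
    rw [var_lie_torus, map_add, map_smul, map_smul] at h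
    have h' := sub_mem (add_mem (Submodule.smul_mem _ (symp F k i) (hV (conj i)))
      (Submodule.smul_mem _ (symp F k (conj i)) (hV i))) h
    rwa [sub_sub_cancel] at h'
  choose t ht using h1
  have ht' : ∀ i k, ⁅var F p m k, D (torus F p m i)⁆ = t k i • 1 := fun i k => (ht k i).symm
  -- The elements x_i x_{i'} and x_j x_{j'} commute; applying D shows that D(x_j x_{j'}) involves
  -- only x_j and x_{j'}.
  have hcomm : ∀ i j, i ≠ j → i ≠ conj j → t i j = 0 := by
    intro i j hij hij'
    have h := lie_of_mem_consts
      (derModConsts_lie hD (topCoeff_torus hp i) (topCoeff_torus hp j)) (var F p m i)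
    rw [torus_lie_torus, map_zero, ← lie_skew (D (torus F p m i)), zero_sub, lie_neg, lie_add, lie_neg,
      var_lie_torus_lie_linear (ht' i), var_lie_torus_lie_linear (ht' j), symp_conj,
      symp_of_ne (conj_ne i).symm, symp_of_ne (fun h => hij (conj_injective h.symm)),
      symp_of_ne (fun h => hij' (by rw [h, conj_conj]))] at h
    simp only [mul_zero, add_zero, zero_smul, neg_zero, zero_add] at h
    rw [← neg_smul, ← zero_smul F] at h
    exact (mul_eq_zero.1 (neg_eq_zero.1 (smul_one_inj hp h))).resolve_right (sgn_cast_ne_zero i)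
  have hconj : ∀ k j, t k (conj j) = t k j := by
    intro k j
    have h := ht k (conj j)
    rw [torus_conj, ht'] at h
    exact smul_one_inj hp h
  -- The only surviving data are the numbers t k k, and this linear form is chosen so that ad w
  -- takes the same values on the torus modulo constants. It sends variables to constants, so the
  -- normalization there is kept.
  let w : TruncPoly F p m := ∑ k, (-t (conj k) (conj k)) • var F p m k
  have hw : ∀ k, ⁅var F p m k, w⁆ = (-(sgn k : F) * t k k) • 1 := by
    intro k
    rw [lie_sum, Finset.sum_eq_single (conj k)]
    · rw [bracket_smul, bracket_var_var', symp_conj, smul_smul, conj_conj]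
      congr 1
      ring
    · intro j _ hj
      rw [bracket_smul, bracket_var_var', symp_of_ne hj, zero_smul, smul_zero]
    · simp
  refine ⟨w, fun k => ?_, fun j => mem_consts_of_bracket fun k => ?_⟩
  · rw [LinearMap.sub_apply, adL_apply, ← lie_skew, hw]
    exact sub_mem (hV k) (neg_mem (smul_one_mem_consts _))
  · rw [LinearMap.sub_apply, adL_apply, ← lie_skew w, sub_neg_eq_add, lie_add, ht',
      var_lie_torus_lie_linear hw, ← add_smul]
    have hs := sgn_cast_mul_self (m := m) F
    suffices t k j + (-(sgn (conj j) : F) * t (conj j) (conj j) * symp F k j +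
        -(sgn j : F) * t j j * symp F k (conj j)) = 0 by rw [this, zero_smul]
    by_cases hkj : k = j
    · subst hkj
      rw [symp_conj, symp_of_ne (conj_ne k).symm]
      linear_combination (-t k k) * hs k
    by_cases hkj' : k = conj j
    · subst hkj'
      rw [symp_of_ne (conj_ne (conj j)).symm, ← hconj]
      have : symp F (conj j) j = sgn (conj j) := by
        conv_lhs => rw [← conj_conj j, conj_conj (conj j)]
        exact symp_conj _
      rw [this]
      linear_combination (-t (conj j) (conj j)) * hs (conj j)
    · rw [hcomm k j hkj hkj', symp_of_ne (fun h => hkj (conj_injective h.symm)),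
        symp_of_ne fun h => hkj' (by rw [h, conj_conj])]
      ring

theorem partialD_mono_add (l : Idx m) (c : Idx m → ℕ) :
    partialD F p m l (mono F p m (c + Pi.single l 1)) = ((c l : F) + 1) • mono F p m c := by
  rw [partialD_mono, add_tsub_cancel_right]
  simp

theorem mono_single_lie (i : Idx m) (n : ℕ) (f : TruncPoly F p m) :
    ⁅mono F p m (Pi.single i n), f⁆ =
      ((sgn i : F) * n) • (mono F p m (Pi.single i (n - 1)) * partialD F p m (conj i) f) := by
  rw [bracket_eq_sum, Finset.sum_eq_single i]
  · have h : (Pi.single i n - Pi.single i 1 : Idx m → ℕ) = Pi.single i (n - 1) := by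
      ext j
      by_cases hj : j = i
      · subst hj; simp
      · simp [hj]
    rw [partialD_mono, Pi.single_eq_same, h, mul_smul, smul_mul_assoc, Algebra.smul_def (sgn i : F),
      map_intCast]
  · intro j _ hj
    rw [partialD_mono_single hj, zero_mul, mul_zero]
  · simp

theorem exists_add_single {a : Idx m → ℕ} {l : Idx m} {n : ℕ} (h : n ≤ a l) :
    ∃ c : Idx m → ℕ, a = c + Pi.single l n := by
  refine ⟨a - Pi.single l n, ?_⟩
  ext j
  by_cases hj : j = l
  · subst hj; simp; omega
  · simp [hj]

theorem sum_add_single (c : Idx m → ℕ) (l : Idx m) (n : ℕ) :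
    ∑ k, (c + Pi.single l n : Idx m → ℕ) k = ∑ k, c k + n := by
  simp only [Pi.add_apply, Finset.sum_add_distrib]
  rw [Finset.sum_pi_single']
  simp

theorem mem_of_smul_mem {T : Submodule F (TruncPoly F p m)} {c : F} {f : TruncPoly F p m}
    (hc : c ≠ 0) (h : c • f ∈ T) : f ∈ T := by
  simpa [smul_smul, hc] using T.smul_mem c⁻¹ h

/-- Monomials of degree `N` whose weight is that of a variable, with a factor `x_l x_{l'}`. -/
theorem mono_mem_of_weight_of_pos (hp : 5 ≤ p) {T : Submodule F (TruncPoly F p m)}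
    (hT : ∀ f ∈ T, ∀ g ∈ T, ⁅f, g⁆ ∈ T) {N : ℕ} (hN : 3 ≤ N)
    (hlow : ∀ b : Idx m → ℕ, ∑ k, b k < N → mono F p m b ∈ T)
    (hwt : ∀ b : Idx m → ℕ, ∑ k, b k = N → ∀ l, ∀ d : F, (b l : F) - b (conj l) = d →
      d ≠ 0 → d ≠ 1 → d ≠ -1 → mono F p m b ∈ T)
    {a : Idx m → ℕ} (ha : ∑ k, a k = N) {l : Idx m} (hl : (a l : F) = a (conj l) + 1)
    (hpos : 1 ≤ a (conj l)) (hlt : a l + 1 < p) : mono F p m a ∈ T := by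
  have h2 : (2 : F) ≠ 0 := two_ne_zero_of_five_le hp
  have h3 : (3 : F) ≠ 0 := natCast_ne_zero (a := 3) (p := p) (by omega) (by omega)
  have h4 : (4 : F) ≠ 0 := natCast_ne_zero (a := 4) (p := p) (by omega) (by omega)
  obtain ⟨c, rfl⟩ := exists_add_single hpos
  have hc : ∑ k, c k + 1 = N := by rw [← ha, sum_add_single]
  have hne : l ≠ conj l := (conj_ne l).symm
  simp only [Pi.add_apply, Pi.single_eq_same, Pi.single_eq_of_ne hne, add_zero] at hl hlt
  -- Replacing one factor x_{l'} by x_l raises the weight difference from 1 to 3, which the weight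
  -- hypothesis covers. Bracketing with x_{l'}^2 goes back to x^a; its scalar is nonzero because a_l
  -- + 1 < p.
  have hb : mono F p m (c + Pi.single l 1) ∈ T := by
    refine hwt _ (by rw [sum_add_single, hc]) l 3 ?_ h3 ?_ ?_
    · simp only [Pi.add_apply, Pi.single_eq_same, Pi.single_eq_of_ne hne.symm, add_zero]
      push_cast
      rw [hl]
      push_cast
      ring
    · exact fun h => h2 (by linear_combination h)
    · exact fun h => h4 (by linear_combination h)
  have h := hT _ (hlow (Pi.single (conj l) 2) (by rw [Finset.sum_pi_single']; simp; omega)) _ hb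
  rw [mono_single_lie, conj_conj, partialD_mono_add, mul_smul_comm, mono_mul, smul_smul,
    add_comm (Pi.single _ _) c] at h
  refine mem_of_smul_mem ?_ h
  refine mul_ne_zero (mul_ne_zero (sgn_cast_ne_zero _) (by exact_mod_cast h2)) ?_
  exact_mod_cast natCast_ne_zero (F := F) (p := p) (Nat.succ_ne_zero (c l)) hlt

/-- Monomials of degree `N` whose weight is that of a variable. -/
theorem mono_mem_of_weight (hp : 5 ≤ p) {T : Submodule F (TruncPoly F p m)}
    (hT : ∀ f ∈ T, ∀ g ∈ T, ⁅f, g⁆ ∈ T) {N : ℕ} (hN : 2 ≤ N)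
    (hlow : ∀ b : Idx m → ℕ, ∑ k, b k < N → mono F p m b ∈ T)
    (hwt : ∀ b : Idx m → ℕ, ∑ k, b k = N → ∀ l, ∀ d : F, (b l : F) - b (conj l) = d →
      d ≠ 0 → d ≠ 1 → d ≠ -1 → mono F p m b ∈ T)
    {a : Idx m → ℕ} (ha : ∑ k, a k = N) (hap : ∀ k, a k < p) {l : Idx m}
    (hl : (a l : F) = a (conj l) + 1)
    (hother : ∀ i, i ≠ l → i ≠ conj l → (a i : F) = a (conj i)) : mono F p m a ∈ T := by
  have h2 : (2 : F) ≠ 0 := two_ne_zero_of_five_le hp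
  have h3 : (3 : F) ≠ 0 := natCast_ne_zero (a := 3) (p := p) (by omega) (by omega)
  have hne : l ≠ conj l := (conj_ne l).symm
  have hle : ∀ s : Finset (Idx m), ∑ k ∈ s, a k ≤ N := fun s => by
    rw [← ha]
    exact Finset.sum_le_sum_of_subset (Finset.subset_univ s)
  rcases Nat.eq_zero_or_pos (a (conj l)) with h0 | hpos
  -- Without a factor x_{l'} the exponent of x_l is 1. As the degree is at least 2, another pair x_j
  -- x_{j'} must divide the monomial.
  · have hal : a l = 1 := by
      rw [h0, Nat.cast_zero, zero_add] at hl
      have h1 : a l ≠ 0 := fun h => by simp [h] at hl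
      by_contra h
      refine natCast_ne_zero (F := F) (p := p) (a := a l - 1) (by omega) (by have := hap l; omega) ?_
      rw [Nat.cast_sub (by omega), hl, Nat.cast_one, sub_self]
    obtain ⟨j, hjl, hj0⟩ : ∃ j, j ≠ l ∧ a j ≠ 0 := by
      by_contra! h
      rw [Finset.sum_eq_single l (fun j _ hj => h j hj) (by simp), hal] at ha
      omega
    have hjl' : j ≠ conj l := by rintro rfl; exact hj0 h0
    have hj'0 : a (conj j) ≠ 0 := by
      intro h
      have h1 := hother j hjl hjl'
      rw [h, Nat.cast_zero] at h1
      exact natCast_ne_zero hj0 (hap j) h1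
    have hjl'' : conj j ≠ l := fun h => hjl' (by rw [← h, conj_conj])
    have hjl''' : conj j ≠ conj l := fun h => hjl (conj_injective h)
    have hjj : j ≠ conj j := (conj_ne j).symm
    have hN3 : 3 ≤ N := by
      have h := hle {l, j, conj j}
      rw [Finset.sum_insert (by simp [hjl.symm, hjl''.symm]), Finset.sum_pair hjj] at h
      omega
    obtain ⟨c, rfl⟩ := exists_add_single (Nat.one_le_iff_ne_zero.2 hj0)
    rw [Pi.add_apply, Pi.single_eq_of_ne hjj.symm, add_zero] at hj'0
    obtain ⟨e, rfl⟩ := exists_add_single (Nat.one_le_iff_ne_zero.2 hj'0)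
    simp only [Pi.add_apply, Pi.single_eq_of_ne hjl.symm, Pi.single_eq_of_ne hjl''.symm,
      Pi.single_eq_of_ne hjl'.symm, Pi.single_eq_of_ne hjl'''.symm, add_zero] at hal h0
    rw [sum_add_single, sum_add_single] at ha
    -- Trading x_j for x_l gives weight difference 2. The bracket of this monomial with x_j x_{l'}
    -- is a nonzero multiple of x^a plus a multiple of the monomial `he`, which does contain x_l
    -- x_{l'}.
    have hb : mono F p m (e + Pi.single (conj j) 1 + Pi.single l 1) ∈ T := by
      refine hwt _ (by rw [sum_add_single, sum_add_single, ha]) l 2 ?_ h2 ?_ ?_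
      · simp only [Pi.add_apply, Pi.single_eq_same, Pi.single_eq_of_ne hjl''.symm,
          Pi.single_eq_of_ne hne.symm, Pi.single_eq_of_ne hjl'''.symm, hal, h0]
        norm_num
      · exact fun h => one_ne_zero (α := F) (by linear_combination h)
      · exact fun h => h3 (by linear_combination h)
    have he : mono F p m (e + Pi.single l 1 + Pi.single (conj l) 1) ∈ T := by
      refine mono_mem_of_weight_of_pos hp hT hN3 hlow hwt (l := l) ?_ ?_ ?_ ?_
      · rw [sum_add_single, sum_add_single, ha]
      · simp only [Pi.add_apply, Pi.single_eq_same, Pi.single_eq_of_ne hne,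
          Pi.single_eq_of_ne hne.symm, hal, h0]
        norm_num
      · simp
      · simp only [Pi.add_apply, Pi.single_eq_same, Pi.single_eq_of_ne hne, hal]
        omega
    have hq : var F p m j * var F p m (conj l) ∈ T := by
      rw [var, var, mono_mul]
      refine hlow _ ?_
      rw [sum_add_single, Finset.sum_pi_single']
      simp
      omega
    have h := hT _ hq _ hb
    have e1 : e + Pi.single (conj j) 1 + Pi.single l 1 =
      e + Pi.single l 1 + Pi.single (conj j) 1 := add_right_comm _ _ _
    rw [mul_bracket, var_bracket, conj_conj, partialD_mono_add, var_bracket, e1, partialD_mono_add,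
      smul_mul_assoc, smul_mul_assoc, mul_smul_comm, mul_smul_comm, var, var, mono_mul, mono_mul,
      smul_smul, smul_smul, add_comm (Pi.single j 1 : Idx m → ℕ)] at h
    have h' := (Submodule.add_mem_iff_left T (T.smul_mem _ he)).1 h
    refine mem_of_smul_mem (mul_ne_zero (sgn_cast_ne_zero _) ?_) h'
    simp only [Pi.add_apply, Pi.single_eq_of_ne hjl''.symm, hal, add_zero]
    norm_num
    exact h2
  by_cases hlt : a l + 1 < p
  · refine mono_mem_of_weight_of_pos hp hT ?_ hlow hwt ha hl hpos hlt
    have h := hle {l, conj l}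
    rw [Finset.sum_pair hne] at h
    by_contra hN'
    have hal : a l ≠ 0 := by
      intro h0
      rw [h0, Nat.cast_zero] at hl
      rw [h0] at h
      have h5 : a (conj l) ≤ 2 := by omega
      refine natCast_ne_zero (F := F) (p := p) (a := a (conj l) + 1) (by omega) (by omega) ?_
      rw [Nat.cast_add_one, ← hl]
    have h5 : a (conj l) = 1 := by omega
    have h6 : a l = 1 := by omega
    rw [h5, h6] at hl
    refine one_ne_zero (α := F) ?_
    rw [Nat.cast_one] at hl
    linear_combination -hl
  -- Here x_l cannot be raised. Instead x^a comes from x_l^3 and a monomial of degree N - 1; the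
  -- factor a_{l'} + 1 equals a_l = -1 in F, hence is nonzero.
  · have hal : a l = p - 1 := by have := hap l; omega
    have h4 : 4 ≤ N := by
      have h := hle {l}
      rw [Finset.sum_singleton] at h
      omega
    obtain ⟨c, rfl⟩ := exists_add_single (a := a) (l := l) (n := 2) (by omega)
    rw [sum_add_single] at ha
    have hl0 := natCast_ne_zero (F := F) (p := p) (a := p - 1) (by omega) (by omega)
    rw [← hal, hl] at hl0
    simp only [Pi.add_apply, Pi.single_eq_of_ne hne.symm, add_zero] at hl0
    have h := hT _ (hlow (Pi.single l 3) (by rw [Finset.sum_pi_single']; simp; omega)) _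
      (hlow (c + Pi.single (conj l) 1) (by rw [sum_add_single]; omega))
    rw [mono_single_lie, partialD_mono_add, mul_smul_comm, mono_mul, smul_smul,
      add_comm (Pi.single _ _) c] at h
    refine mem_of_smul_mem (mul_ne_zero (mul_ne_zero (sgn_cast_ne_zero _) ?_) hl0) h
    exact_mod_cast h3

/-- A derivation that kills the variables and the torus is zero. -/
theorem derModConsts_eq_zero (hp : 5 ≤ p) (hD : D ∈ derModConsts F p m)
    (hV : ∀ k, D (var F p m k) ∈ consts F p m) (hH : ∀ k, D (torus F p m k) ∈ consts F p m)
    (N : ℕ) (a : Idx m → ℕ) (ha : ∑ k, a k = N) (htop : a ≠ fun _ => p - 1) :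
    D (mono F p m a) ∈ consts F p m := by
  induction N using Nat.strong_induction_on generalizing a with
  | _ N IH =>
  by_cases hap : ∀ k, a k < p
  swap
  · push Not at hap
    obtain ⟨k, hk⟩ := hap
    rw [mono_eq_zero hk, map_zero]
    exact zero_mem _
  rcases Nat.lt_or_ge N 2 with hN | hN
  · interval_cases N
    · have h : a = 0 := by
        ext k
        simpa using (Finset.sum_eq_zero_iff.1 ha) k (Finset.mem_univ k)
      rw [h, mono_zero]
      exact hD.1
    · obtain ⟨k, hk⟩ : ∃ k, a k ≠ 0 := by
        by_contra! h
        simp [h] at ha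
      obtain ⟨c, rfl⟩ := exists_add_single (Nat.one_le_iff_ne_zero.2 hk)
      rw [sum_add_single] at ha
      have h : c = 0 := by
        ext k
        simpa using (Finset.sum_eq_zero_iff.1 (Nat.succ_injective ha)) k (Finset.mem_univ k)
      rw [h, zero_add]
      exact hV k
  have hNtop : N ≤ ∑ _k : Idx m, (p - 1) := by
    rw [← ha]
    exact Finset.sum_le_sum fun k _ => by have := hap k; omega
  -- A subspace closed under brackets; every further monomial will be reached by brackets inside it.
  let T : Submodule F (TruncPoly F p m) :=
    (consts F p m).comap D ⊓ LinearMap.ker (topCoeff F p m)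
  have hTtop : ∀ {f}, f ∈ T → topCoeff F p m f = 0 := fun hf => hf.2
  have hT : ∀ f ∈ T, ∀ g ∈ T, ⁅f, g⁆ ∈ T := by
    intro f hf g hg
    refine ⟨?_, topCoeff_bracket f g⟩
    have h := derModConsts_lie_mem hD (hTtop hf) (hTtop hg) hf.1
    rwa [lie_of_mem_consts hg.1, sub_zero] at h
  have hlow : ∀ b : Idx m → ℕ, ∑ k, b k < N → mono F p m b ∈ T := by
    intro b hb
    have hb' : b ≠ fun _ => p - 1 := by
      rintro rfl
      exact absurd hNtop (not_le.2 hb)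
    exact ⟨IH _ hb b rfl hb', coeffN_mono_ne hb'⟩
  -- By the induction hypothesis D(x^b) is linear modulo constants. D commutes with the torus modulo
  -- constants, so if D(x^b) is not constant, x^b has the torus weight of some variable.
  have hweight : ∀ b : Idx m → ℕ, ∑ k, b k = N → (b ≠ fun _ => p - 1) → mono F p m b ∈ T ∨
      ∃ l, (b l : F) = b (conj l) + 1 ∧ ∀ i, i ≠ l → i ≠ conj l → (b i : F) = b (conj i) := by
    intro b hb hbtop
    have htc : topCoeff F p m (mono F p m b) = 0 := coeffN_mono_ne hbtop
    by_cases hmem : D (mono F p m b) ∈ consts F p m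
    · exact Or.inl ⟨hmem, htc⟩
    right
    have h1 : ∀ k, ∃ t : F, t • (1 : TruncPoly F p m) = ⁅var F p m k, D (mono F p m b)⁆ := by
      intro k
      refine Submodule.mem_span_singleton.1 ?_
      have h := derModConsts_lie_mem hD (topCoeff_var hp k) htc (hV k)
      have h' : D ⁅var F p m k, mono F p m b⁆ ∈ consts F p m := by
        rw [var_bracket, partialD_mono]
        by_cases h0 : b (conj k) = 0
        · simp [h0]
        obtain ⟨c, rfl⟩ := exists_add_single (Nat.one_le_iff_ne_zero.2 h0)
        rw [add_tsub_cancel_right, map_smul, map_smul]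
        refine Submodule.smul_mem _ _ (Submodule.smul_mem _ _ (hlow c ?_).1)
        rw [sum_add_single] at hb
        omega
      have h2 := sub_mem h' h
      rwa [sub_sub_cancel] at h2
    choose t ht using h1
    have ht' : ∀ k, ⁅var F p m k, D (mono F p m b)⁆ = t k • 1 := fun k => (ht k).symm
    have hrel : ∀ i k, (sgn i : F) * (b (conj i) - b i) * t k =
        t (conj i) * symp F k i + t i * symp F k (conj i) := by
      intro i k
      have h := lie_of_mem_consts (derModConsts_lie_mem hD (topCoeff_torus hp i) htc (hH i))
        (var F p m k)
      rw [torus_lie_mono, map_smul, lie_sub, bracket_smul, ht', var_lie_torus_lie_linear ht',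
        smul_smul, sub_eq_zero] at h
      exact smul_one_inj hp h
    obtain ⟨k, hk⟩ : ∃ k, t k ≠ 0 := by
      by_contra! h
      exact hmem (mem_consts_of_bracket fun k => by rw [ht', h, zero_smul])
    refine ⟨conj k, ?_, fun i hi hi' => ?_⟩
    · have h := hrel k k
      rw [symp_conj, symp_of_ne (conj_ne k).symm, mul_zero, zero_add, mul_comm (t k)] at h
      have h' := mul_left_cancel₀ (sgn_cast_ne_zero k) ((mul_right_cancel₀ hk h).trans
        (mul_one (sgn k : F)).symm)
      rw [conj_conj]
      linear_combination h'
    · rw [conj_conj] at hi'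
      have h := hrel i k
      rw [symp_of_ne hi, symp_of_ne fun h => hi' (conj_injective h), mul_zero, mul_zero,
        add_zero] at h
      have h' := (mul_eq_zero.1 ((mul_eq_zero.1 h).resolve_right hk)).resolve_left
        (sgn_cast_ne_zero i)
      linear_combination -h'
  have hwt : ∀ b : Idx m → ℕ, ∑ k, b k = N → ∀ l, ∀ d : F, (b l : F) - b (conj l) = d →
      d ≠ 0 → d ≠ 1 → d ≠ -1 → mono F p m b ∈ T := by
    intro b hb l d hd h0 h1 hm1
    refine (hweight b hb ?_).resolve_right ?_
    · rintro rfl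
      exact h0 (by rw [← hd, sub_self])
    rintro ⟨i, hi, hother⟩
    by_cases hl : l = i
    · subst hl
      exact h1 (by rw [← hd, hi]; ring)
    by_cases hl' : l = conj i
    · subst hl'
      exact hm1 (by rw [← hd, conj_conj, hi]; ring)
    · exact h0 (by rw [← hd, hother l hl hl', sub_self])
  rcases hweight a ha htop with h | ⟨l, hl, hother⟩
  · exact h.1
  · exact (mono_mem_of_weight hp hT hN hlow hwt ha hap hl hother).1

end Vanishing

end HamiltonianLie

/-! ### The classification of derivations from H(n) to A(n)/⟨1⟩. -/

namespace HamiltonianLie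

section Classification

variable {F : Type*} [Field F] {p m : ℕ}

theorem expo_ne_zero (a : Expo p m) : a.toNat ≠ 0 := fun h => by
  obtain ⟨k, hk⟩ := a.2.1
  exact hk (congrFun h k)

theorem expo_ne_top (a : Expo p m) : a.toNat ≠ fun _ => p - 1 := fun h => by
  obtain ⟨k, hk⟩ := a.2.2
  exact hk (congrFun h k)

theorem expo_toNat_injective : Function.Injective (Expo.toNat (p := p) (m := m)) := fun _ _ h =>
  Subtype.ext (funext fun k => Fin.ext (congrFun h k))

theorem exists_expo {a : Idx m → ℕ} (ha : ∀ k, a k < p) (h0 : a ≠ 0)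
    (htop : a ≠ fun _ => p - 1) : ∃ b : Expo p m, b.toNat = a :=
  ⟨⟨fun k => ⟨a k, ha k⟩, Function.ne_iff.1 h0, Function.ne_iff.1 htop⟩, rfl⟩

variable [CharP F p]

theorem topCoeff_mono_expo (a : Expo p m) : topCoeff F p m (mono F p m a.toNat) = 0 :=
  coeffN_mono_ne (expo_ne_top a)

/-- The expansion of an element of the hyperplane `∫ f = 0`. -/
theorem eq_sum_expo {f : TruncPoly F p m} (hf : topCoeff F p m f = 0) :
    f = coeffN F p m 0 f • 1 + ∑ a : Expo p m, coeffN F p m a.toNat f • mono F p m a.toNat := by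
  refine ext_coeffN fun d hd => ?_
  rw [map_add, map_smul, ← mono_zero, map_sum]
  simp only [map_smul, smul_eq_mul]
  by_cases h0 : d = 0
  · subst h0
    rw [coeffN_mono_self hd, mul_one, Finset.sum_eq_zero, add_zero]
    intro a _
    rw [coeffN_mono_ne (expo_ne_zero a), mul_zero]
  rw [coeffN_mono_ne (Ne.symm h0), mul_zero, zero_add]
  by_cases htop : d = fun _ => p - 1
  · subst htop
    rw [Finset.sum_eq_zero]
    · exact hf
    · intro a _
      rw [coeffN_mono_ne (expo_ne_top a), mul_zero]
  obtain ⟨b, rfl⟩ := exists_expo hd h0 htop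
  rw [Finset.sum_eq_single b]
  · rw [coeffN_mono_self hd, mul_one]
  · intro a _ ha
    rw [coeffN_mono_ne (fun h => ha (expo_toNat_injective h)), mul_zero]
  · simp

/-- The derivations from `H(n)` to `A(n) / ⟨1⟩`: they are spanned by the inner derivations of
`A(n)`, the `powDer i` and the degree derivation. -/
theorem exists_of_mem_derModConsts (hp : 5 ≤ p) {D : TruncPoly F p m →ₗ[F] TruncPoly F p m}
    (hD : D ∈ derModConsts F p m) :
    ∃ (g : TruncPoly F p m) (c : Idx m → F) (κ : F), ∀ f, topCoeff F p m f = 0 →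
      D f - (⁅g, f⁆ + ∑ i, c i • powDer F p m i f + κ • degDer F p m f) ∈ consts F p m := by
  obtain ⟨g, c, b, hb, hanti⟩ := exists_sub_linear hp hD
  have hD1 : D - adL F p m g - ∑ i, c i • powDer F p m i ∈ derModConsts F p m :=
    sub_mem (sub_mem hD (adL_mem g)) (sum_mem fun i _ => Submodule.smul_mem _ _ (powDer_mem i))
  obtain ⟨κ, hκ⟩ := exists_scalar_of_skew hp hD1 hb hanti
  -- The degree derivation is -1 on each variable, so adding κ times it cancels the scalar κ.
  have hD2 := add_mem hD1 (Submodule.smul_mem _ κ degDer_mem)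
  have hV : ∀ k, (D - adL F p m g - ∑ i, c i • powDer F p m i + κ • degDer F p m)
      (var F p m k) ∈ consts F p m := by
    intro k
    have h : degDer F p m (var F p m k) = -var F p m k := by
      rw [var, degDer_mono, Finset.sum_pi_single']
      simp only [Finset.mem_univ, if_true, Nat.cast_one]
      rw [← neg_one_smul F]
      congr 1
      norm_num
    rw [LinearMap.add_apply, LinearMap.smul_apply, h, smul_neg, ← sub_eq_add_neg]
    exact hκ k
  obtain ⟨w, hwV, hwH⟩ := exists_sub_adL_torus hp hD2 hV
  have hD3 := sub_mem hD2 (adL_mem (F := F) (p := p) w)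
  refine ⟨g + w, c, -κ, fun f hf => ?_⟩
  have h : D f - (⁅g + w, f⁆ + ∑ i, c i • powDer F p m i f + (-κ) • degDer F p m f) =
      (D - adL F p m g - ∑ i, c i • powDer F p m i + κ • degDer F p m - adL F p m w) f := by
    simp only [LinearMap.sub_apply, LinearMap.add_apply, LinearMap.smul_apply,
      LinearMap.sum_apply, adL_apply, add_lie, neg_smul]
    abel
  rw [h, eq_sum_expo hf, map_add, map_sum, map_smul]
  refine add_mem (Submodule.smul_mem _ _ hD3.1) (sum_mem fun a _ => ?_)
  rw [map_smul]
  exact Submodule.smul_mem _ _ (derModConsts_eq_zero hp hD3 hwV hwH _ _ rfl (expo_ne_top a))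

end Classification

/-! ### H(n) as the hyperplane ∫ f = 0 modulo constants. -/

section Projection

variable {F : Type*} [Field F] {p m : ℕ} [CharP F p]

variable (F p m) in
/-- The projection from `A(n)` to the hyperplane `∫ f = 0` along `x_1 ^ (p - 1) ⋯ x_n ^ (p - 1)`,
followed by the quotient map to `H'(n)`. -/
noncomputable def toHPrime : TruncPoly F p m →ₗ[F] HPrime F p m :=
  (constIdeal F p m).toSubmodule.mkQ ∘ₗ
    (LinearMap.id - (topCoeff F p m).smulRight (mono F p m fun _ => p - 1))

theorem toHPrime_apply {f : TruncPoly F p m} (hf : topCoeff F p m f = 0) :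
    toHPrime F p m f = LieSubmodule.Quotient.mk f := by
  simp only [toHPrime, LinearMap.comp_apply, LinearMap.sub_apply, LinearMap.smulRight_apply, hf,
    zero_smul, sub_zero, LinearMap.id_apply]
  rfl

theorem toHPrime_mem (hp : 5 ≤ p) (f : TruncPoly F p m) : toHPrime F p m f ∈
    ⁅(⊤ : LieIdeal F (HPrime F p m)), (⊤ : LieIdeal F (HPrime F p m))⁆ := by
  induction f using mono_induction with
  | hadd f g hf hg => rw [map_add]; exact add_mem hf hg
  | hsmul c f hf => rw [map_smul]; exact Submodule.smul_mem _ c hf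
  | hmono a =>
    by_cases hap : ∀ k, a k < p
    swap
    · push Not at hap
      obtain ⟨k, hk⟩ := hap
      rw [mono_eq_zero hk, map_zero]
      exact zero_mem _
    by_cases ha : a = fun _ => p - 1
    · have h : toHPrime F p m (mono F p m a) = 0 := by
        simp only [toHPrime, LinearMap.comp_apply, LinearMap.sub_apply, LinearMap.smulRight_apply,
          LinearMap.id_apply, topCoeff]
        rw [← ha, coeffN_mono_self hap, one_smul, sub_self, map_zero]
      rw [h]
      exact zero_mem _
    -- An exponent below p - 1 can be raised, so x^a is a nonzero multiple of a partial derivative,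
    -- that is, of a bracket with a variable.
    obtain ⟨k, hk⟩ := Function.ne_iff.1 ha
    have hk' : a k + 1 < p := by have := hap k; omega
    rw [toHPrime_apply (coeffN_mono_ne ha)]
    have h : mono F p m a = ((sgn (conj k) : F) * ((a k : F) + 1))⁻¹ •
        ⁅var F p m (conj k), mono F p m (a + Pi.single k 1)⁆ := by
      rw [var_bracket, conj_conj, partialD_mono_add, smul_smul, smul_smul, mul_assoc,
        inv_mul_cancel₀, one_smul]
      refine mul_ne_zero (sgn_cast_ne_zero _) ?_
      exact_mod_cast natCast_ne_zero (F := F) (p := p) (Nat.succ_ne_zero (a k)) hk'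
    rw [h]
    exact Submodule.smul_mem _ _ (LieSubmodule.lie_mem_lie
      (x := (LieSubmodule.Quotient.mk (var F p m (conj k)) : HPrime F p m))
      (m := (LieSubmodule.Quotient.mk (mono F p m (a + Pi.single k 1)) : HPrime F p m))
      (LieSubmodule.mem_top _) (LieSubmodule.mem_top _))

/-- The projection from `A(n)` to `H(n)`, which is a homomorphism on the hyperplane `∫ f = 0`. -/
noncomputable def toH (hp : 5 ≤ p) : TruncPoly F p m →ₗ[F] HAlg F p m :=
  (toHPrime F p m).codRestrict (LieSubmodule.toSubmodule
    ⁅(⊤ : LieIdeal F (HPrime F p m)), (⊤ : LieIdeal F (HPrime F p m))⁆) (toHPrime_mem hp)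

theorem toH_coe (hp : 5 ≤ p) {f : TruncPoly F p m} (hf : topCoeff F p m f = 0) :
    (toH hp f : HPrime F p m) = LieSubmodule.Quotient.mk f :=
  toHPrime_apply hf

theorem toH_lie (hp : 5 ≤ p) {f g : TruncPoly F p m} (hf : topCoeff F p m f = 0)
    (hg : topCoeff F p m g = 0) : toH hp ⁅f, g⁆ = ⁅toH hp f, toH hp g⁆ := by
  refine Subtype.ext ?_
  rw [toH_coe hp (topCoeff_bracket f g)]
  have h : ((⁅toH hp f, toH hp g⁆ : HAlg F p m) : HPrime F p m) =
    ⁅(toH hp f : HPrime F p m), (toH hp g : HPrime F p m)⁆ := rfl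
  rw [h, toH_coe hp hf, toH_coe hp hg]
  rfl

theorem toH_surjective (hp : 5 ≤ p) (x : HAlg F p m) :
    ∃ f : TruncPoly F p m, topCoeff F p m f = 0 ∧ toH hp f = x := by
  have h : LieSubmodule.toSubmodule
      ⁅(⊤ : LieIdeal F (HPrime F p m)), (⊤ : LieIdeal F (HPrime F p m))⁆ ≤
      (LinearMap.ker (topCoeff F p m)).map (constIdeal F p m).toSubmodule.mkQ := by
    rw [LieSubmodule.lieIdeal_oper_eq_linear_span, Submodule.span_le]
    rintro _ ⟨⟨u, -⟩, ⟨v, -⟩, rfl⟩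
    obtain ⟨f, rfl⟩ := LieSubmodule.Quotient.surjective_mk' (constIdeal F p m) u
    obtain ⟨g, rfl⟩ := LieSubmodule.Quotient.surjective_mk' (constIdeal F p m) v
    exact ⟨⁅f, g⁆, topCoeff_bracket f g, rfl⟩
  obtain ⟨f, hf, hfx⟩ := h x.2
  exact ⟨f, hf, Subtype.ext ((toH_coe hp hf).trans hfx)⟩

theorem toH_one (hp : 5 ≤ p) (hm : 1 ≤ m) : toH hp (1 : TruncPoly F p m) = 0 := by
  refine Subtype.ext ?_
  rw [toH_coe]
  · exact (Submodule.Quotient.mk_eq_zero _).2 (Submodule.mem_span_singleton_self _)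
  · rw [← mono_zero]
    exact topCoeff_mono_of_ne (k := .inl ⟨0, hm⟩) (by simp only [Pi.zero_apply]; omega)

theorem coeffH_toH (hp : 5 ≤ p) (a : Expo p m) {f : TruncPoly F p m} (hf : topCoeff F p m f = 0) :
    coeffH F p m a (toH hp f) = coeffN F p m a.toNat f := by
  have h : coeffH F p m a (toH hp f) = coeffHPrime F p m a (toH hp f : HPrime F p m) := rfl
  rw [h, toH_coe hp hf]
  exact (coeffN_val a.1 f).symm

end Projection

end HamiltonianLie

/-! ### The given bilinear maps as forms ∫ D(f) g. -/

namespace HamiltonianLie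

section Representation

variable {F : Type*} [Field F] {p m : ℕ}

theorem coeffN_zero_mono (hp : 5 ≤ p) (a : Idx m → ℕ) [Decidable (a = 0)] :
    coeffN F p m 0 (mono F p m a) = if a = 0 then 1 else 0 := by
  split_ifs with h
  · rw [h]
    exact coeffN_mono_self fun _ => by simp only [Pi.zero_apply]; omega
  · exact coeffN_mono_ne h

variable [CharP F p]

variable (F p m) in
/-- The identification of the trivial module with `F`. -/
noncomputable def trivEquiv : TrivF F p m ≃ₗ[F] F := TrivialLieModule.equiv F (HAlg F p m) F

/-- The bilinear map `c` on `H(n)` is `(f, g) ↦ ∫ D(f) g`. -/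
def Represents (hp : 5 ≤ p) (c : HAlg F p m →ₗ[F] HAlg F p m →ₗ[F] TrivF F p m)
    (D : TruncPoly F p m →ₗ[F] TruncPoly F p m) : Prop :=
  ∀ f g, topCoeff F p m f = 0 → topCoeff F p m g = 0 →
    trivEquiv F p m (c (toH hp f) (toH hp g)) = topCoeff F p m (D f * g)

theorem trivEquiv_bilin (hp : 5 ≤ p) (φ : Expo p m → Expo p m → F) {f g : TruncPoly F p m}
    (hf : topCoeff F p m f = 0) (hg : topCoeff F p m g = 0) :
    trivEquiv F p m (bilin F p m φ (toH hp f) (toH hp g)) =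
      ∑ a, ∑ b, coeffN F p m a.toNat f * (φ a b * coeffN F p m b.toNat g) := by
  simp only [bilin, LinearMap.sum_apply, map_sum, LinearMap.smulRight_apply, LinearMap.smul_apply,
    map_smul, coeffH_toH hp _ hf, smul_eq_mul, LinearMap.comp_apply]
  refine Finset.sum_congr rfl fun a _ => Finset.sum_congr rfl fun b _ => ?_
  rw [coeffH_toH hp _ hg]
  rfl

theorem topCoeff_mul_of_mem_consts {f g : TruncPoly F p m} (hf : f ∈ consts F p m)
    (hg : topCoeff F p m g = 0) : topCoeff F p m (f * g) = 0 := by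
  obtain ⟨c, rfl⟩ := Submodule.mem_span_singleton.1 hf
  rw [smul_mul_assoc, one_mul, map_smul, hg, smul_zero]

/-- The conditions on D 1 and on the image of D make ∫ D(f) g insensitive to constants in f and in
g, so that the values on the basis monomials of H(n) decide. -/
theorem represents_bilin (hp : 5 ≤ p) (φ : Expo p m → Expo p m → F)
    (D : TruncPoly F p m →ₗ[F] TruncPoly F p m)
    (h : ∀ a b : Expo p m, topCoeff F p m (D (mono F p m a.toNat) * mono F p m b.toNat) = φ a b)
    (h1 : D 1 ∈ consts F p m) (h2 : ∀ f, topCoeff F p m f = 0 → topCoeff F p m (D f) = 0) :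
    Represents hp (bilin F p m φ) D := by
  intro f g hf hg
  rw [trivEquiv_bilin hp φ hf hg]
  conv_rhs => rw [eq_sum_expo hf]
  simp only [map_add, map_sum, map_smul, add_mul, Finset.sum_mul, smul_mul_assoc]
  rw [topCoeff_mul_of_mem_consts h1 hg, smul_zero, zero_add]
  refine Finset.sum_congr rfl fun a _ => ?_
  conv_rhs => rw [eq_sum_expo hg]
  simp only [mul_add, map_add, Finset.mul_sum, map_sum, mul_smul_comm, map_smul, mul_one]
  rw [h2 _ (topCoeff_mono_expo a), smul_zero, zero_add, Finset.smul_sum]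
  refine Finset.sum_congr rfl fun b _ => ?_
  rw [h, smul_eq_mul, smul_eq_mul, mul_comm (φ a b)]

theorem topCoeff_mono_eq_ite (hp : 5 ≤ p) (a : Idx m → ℕ) [Decidable (a = fun _ => p - 1)] :
    topCoeff F p m (mono F p m a) = if a = fun _ => p - 1 then 1 else 0 := by
  split_ifs with h
  · rw [h]
    exact coeffN_mono_self fun _ => by omega
  · exact coeffN_mono_ne h

theorem powDer_eq_partialD (i : Idx m) (f : TruncPoly F p m) : powDer F p m i f =
    partialD F p m i (mono F p m (Pi.single (conj i) (p - 1)) * f) := by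
  rw [Derivation.leibniz, partialD_mono_single (conj_ne i).symm, smul_zero, add_zero,
    smul_eq_mul, powDer_apply]

theorem represents_omega (hp : 5 ≤ p) (i : Idx m) :
    Represents hp (omegaCochain F p m i) (powDer F p m i) := by
  classical
  refine represents_bilin hp _ _ (fun a b => ?_) (powDer_mem i).1 fun f _ => ?_
  · rw [powDer_apply, partialD_mono, mul_smul_comm, smul_mul_assoc, map_smul, mono_mul, mono_mul,
      smul_eq_mul]
    by_cases h0 : a.toNat i = 0
    · simp [h0]
    obtain ⟨c, hc⟩ := exists_add_single (Nat.one_le_iff_ne_zero.2 h0)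
    rw [topCoeff_mono_eq_ite hp, mul_ite, mul_one, mul_zero]
    refine if_congr ?_ rfl rfl
    rw [hc, add_tsub_cancel_right]
    have e : c + Pi.single i 1 + b.toNat + Pi.single (conj i) (p - 1) =
        (Pi.single (conj i) (p - 1) + c + b.toNat) + Pi.single i 1 := by abel
    rw [e, add_left_inj]
  · rw [powDer_eq_partialD, topCoeff_partialD]

/-- By invariance the left side pairs x^σ with the bracket, which picks out the constant term. Thus
Σ is the cocycle of the central extension of H(n) by the constants in the hyperplane ∫ f = 0. -/
theorem topCoeff_adL_top (hp : 5 ≤ p) (f g : TruncPoly F p m) :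
    topCoeff F p m (adL F p m (mono F p m fun _ => p - 1) f * g) = coeffN F p m 0 ⁅f, g⁆ := by
  rw [adL_apply, topCoeff_bracket_mul, mul_comm]
  exact topCoeff_mul_mono _ (a := 0) fun _ => by simp only [Pi.zero_apply]; omega

theorem represents_sigma (hp : 5 ≤ p) :
    Represents hp (sigmaCochain F p m) (adL F p m (mono F p m fun _ => p - 1)) := by
  classical
  refine represents_bilin hp _ _ (fun a b => ?_) (adL_mem _).1 fun f _ => topCoeff_bracket _ _
  rw [topCoeff_adL_top hp, bracket_eq_sum, map_sum]
  refine Finset.sum_congr rfl fun j _ => ?_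
  have hsg : (sgn j : TruncPoly F p m) = algebraMap F (TruncPoly F p m) (sgn j : F) :=
    (map_intCast _ _).symm
  rw [hsg, ← Algebra.smul_def, partialD_mono, partialD_mono, smul_mul_smul_comm, mono_mul,
    map_smul, map_smul, coeffN_zero_mono hp, smul_eq_mul, smul_eq_mul]
  by_cases ha : a.toNat j = 0
  · rw [ha, if_neg (c := a.toNat = _ ∧ _)]
    · simp
    · rintro ⟨h, -⟩
      simp [h] at ha
  by_cases hb : b.toNat (conj j) = 0
  · rw [hb, if_neg (c := a.toNat = _ ∧ _)]
    · simp
    · rintro ⟨-, h⟩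
      simp [h] at hb
  obtain ⟨c, hc⟩ := exists_add_single (Nat.one_le_iff_ne_zero.2 ha)
  obtain ⟨d, hd⟩ := exists_add_single (Nat.one_le_iff_ne_zero.2 hb)
  rw [hc, hd, add_tsub_cancel_right, add_tsub_cancel_right]
  by_cases h : c = 0 ∧ d = 0
  · rw [h.1, h.2, if_pos (add_zero _), if_pos ⟨zero_add _, zero_add _⟩]
    simp
  · rw [if_neg fun h' => h (add_eq_zero.1 h'),
      if_neg fun h' => h ⟨add_eq_right.1 h'.1, add_eq_right.1 h'.2⟩, mul_zero, mul_zero]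

/-- Integration by parts: each of the 2m operators x_j ∂_j contributes -∫ f. -/
theorem topCoeff_euler (f : TruncPoly F p m) :
    topCoeff F p m (euler F p m f) = -(2 * m : F) * topCoeff F p m f := by
  have h : ∀ j, var F p m j * partialD F p m j f = partialD F p m j (var F p m j * f) - f := by
    intro j
    rw [Derivation.leibniz, partialD_var, if_pos rfl, smul_eq_mul, smul_eq_mul, mul_one,
      add_sub_cancel_right]
  rw [euler_apply, map_sum]
  simp only [h, map_sub, topCoeff_partialD, zero_sub]
  rw [Finset.sum_neg_distrib, Finset.sum_const, Finset.card_univ, Fintype.card_sum, Fintype.card_fin,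
    nsmul_eq_mul, ← two_mul, neg_mul]
  push_cast
  rfl

/-- The symmetrization of Δ: the Euler part gives -n by integration by parts, and the two degree
shifts give -4. This is the source of the congruence n ≡ -4. -/
theorem topCoeff_degDer_mul_add (f g : TruncPoly F p m) :
    topCoeff F p m (degDer F p m f * g) + topCoeff F p m (degDer F p m g * f) =
      -(2 * m + 4 : F) * topCoeff F p m (f * g) := by
  have h : degDer F p m f * g + degDer F p m g * f =
      euler F p m (f * g) - (4 : F) • (f * g) := by
    rw [degDer_apply, degDer_apply, euler_mul, sub_mul, sub_mul, smul_mul_assoc, smul_mul_assoc,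
      mul_comm g f, mul_comm (euler F p m g)]
    have : (4 : F) • (f * g) = (2 : F) • (f * g) + (2 : F) • (f * g) := by
      rw [← add_smul]
      norm_num
    rw [this]
    abel
  rw [← map_add, h, map_sub, topCoeff_euler, map_smul, smul_eq_mul]
  ring

theorem represents_delta (hp : 5 ≤ p) : Represents hp (deltaCochain F p m) (degDer F p m) := by
  classical
  refine represents_bilin hp _ _ (fun a b => ?_) degDer_mem.1 fun f hf => ?_
  · rw [degDer_mono, smul_mul_assoc, mono_mul, map_smul, topCoeff_mono_eq_ite hp, smul_eq_mul,
      mul_ite, mul_one, mul_zero]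
    refine if_congr Iff.rfl ?_ rfl
    rw [Expo.deg]
    push_cast
    rfl
  · rw [degDer_apply, map_sub, topCoeff_euler, map_smul, hf, mul_zero, smul_zero, sub_zero]

open LieModule.Cohomology

theorem represents_alternating {hp : 5 ≤ p} {c : HAlg F p m →ₗ[F] HAlg F p m →ₗ[F] TrivF F p m}
    {D : TruncPoly F p m →ₗ[F] TruncPoly F p m} (h : Represents hp c D)
    (hD : ∀ f g, topCoeff F p m f = 0 → topCoeff F p m g = 0 →
      topCoeff F p m (D f * g) + topCoeff F p m (D g * f) = 0) :
    c ∈ twoCochain F (HAlg F p m) (TrivF F p m) := by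
  intro x
  obtain ⟨f, hf, rfl⟩ := toH_surjective hp x
  apply (trivEquiv F p m).injective
  rw [h f f hf hf, map_zero]
  have h2 := hD f f hf hf
  rw [← two_mul] at h2
  exact (mul_eq_zero.1 h2).resolve_left (two_ne_zero_of_five_le hp)

/-- By invariance of ∫, the cocycle identity for c is the Leibniz rule for D paired with the third
argument. -/
theorem represents_mem_twoCocycle {hp : 5 ≤ p}
    {c : twoCochain F (HAlg F p m) (TrivF F p m)}
    {D : TruncPoly F p m →ₗ[F] TruncPoly F p m} (h : Represents hp c.1 D)
    (hD : ∀ f g, D ⁅f, g⁆ = ⁅D f, g⁆ + ⁅f, D g⁆) :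
    c ∈ twoCocycle F (HAlg F p m) (TrivF F p m) := by
  rw [mem_twoCocycle_iff_of_trivial]
  intro x y z
  obtain ⟨f, hf, rfl⟩ := toH_surjective hp x
  obtain ⟨g, hg, rfl⟩ := toH_surjective hp y
  obtain ⟨k, hk, rfl⟩ := toH_surjective hp z
  rw [← toH_lie hp hf hg, ← toH_lie hp hf hk, ← toH_lie hp hg hk]
  apply (trivEquiv F p m).injective
  rw [map_add]
  change trivEquiv F p m (c.1 _ _) = trivEquiv F p m (c.1 _ _) + trivEquiv F p m (c.1 _ _)
  rw [h _ _ hf (topCoeff_bracket _ _), h _ _ (topCoeff_bracket _ _) hk,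
    h _ _ hg (topCoeff_bracket _ _), hD, add_mul, map_add, ← topCoeff_bracket_mul,
    ← topCoeff_bracket_mul, ← lie_skew (D g) f, neg_mul, map_neg]
  ring

theorem topCoeff_powDer_mul_add (i : Idx m) (f g : TruncPoly F p m) :
    topCoeff F p m (powDer F p m i f * g) + topCoeff F p m (powDer F p m i g * f) = 0 := by
  have h : powDer F p m i f * g + powDer F p m i g * f = powDer F p m i (f * g) := by
    rw [powDer_apply, powDer_apply, powDer_apply, Derivation.leibniz, smul_eq_mul, smul_eq_mul]
    ring
  rw [← map_add, h, powDer_eq_partialD, topCoeff_partialD]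

theorem omegaCochain_mem (hp : 5 ≤ p) (i : Idx m) :
    omegaCochain F p m i ∈ twoCochain F (HAlg F p m) (TrivF F p m) :=
  represents_alternating (represents_omega hp i) fun f g _ _ => topCoeff_powDer_mul_add i f g

theorem sigmaCochain_mem (hp : 5 ≤ p) :
    sigmaCochain F p m ∈ twoCochain F (HAlg F p m) (TrivF F p m) :=
  represents_alternating (represents_sigma hp) fun f g _ _ => by
    rw [topCoeff_adL_top hp, topCoeff_adL_top hp, ← map_add, ← lie_skew, neg_add_cancel, map_zero]

theorem deltaCochain_mem_iff (hp : 5 ≤ p) (hm : 1 ≤ m) :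
    deltaCochain F p m ∈ twoCochain F (HAlg F p m) (TrivF F p m) ↔ (2 * m + 4 : F) = 0 := by
  constructor
  · intro h
    let k : Idx m := .inl ⟨0, hm⟩
    let a : Idx m → ℕ := Pi.single k 1
    have ha : ∀ j, a j < p := fun j => by
      simp only [a, Pi.single_apply]
      split_ifs <;> omega
    have hf : topCoeff F p m (mono F p m a) = 0 := topCoeff_var hp k
    have hg : topCoeff F p m (mono F p m fun j => p - 1 - a j) = 0 :=
      topCoeff_mono_of_ne (k := k) (by simp only [a, Pi.single_eq_same]; omega)
    -- On x_k and its complementary monomial the product has integral 1, so skew symmetry forces n +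
    -- 4 = 0 in F.
    have h1 := twoCochain_skew ⟨_, h⟩ (toH hp (mono F p m a))
      (toH hp (mono F p m fun j => p - 1 - a j))
    change -(deltaCochain F p m _ _) = deltaCochain F p m _ _ at h1
    have h2 := congrArg (trivEquiv F p m) h1
    rw [map_neg, represents_delta hp _ _ hf hg, represents_delta hp _ _ hg hf,
      neg_eq_iff_add_eq_zero, topCoeff_degDer_mul_add, topCoeff_mul_mono _ ha,
      coeffN_mono_self ha, mul_one, neg_eq_zero] at h2
    exact h2
  · intro h
    refine represents_alternating (represents_delta hp) fun f g _ _ => ?_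
    rw [topCoeff_degDer_mul_add, h, neg_zero, zero_mul]

end Representation

end HamiltonianLie

namespace HamiltonianLie

/-! ### From cocycles to derivations, and the basis of the second cohomology. -/

open LieModule.Cohomology

section SecondCohomology

variable {R L M : Type*} [CommRing R] [LieRing L] [LieAlgebra R L] [AddCommGroup M] [Module R M]
  [LieRingModule L M] [LieModule R L M]

theorem H2_mk_eq_zero_iff (z : twoCocycle R L M) :
    (Submodule.Quotient.mk z : H2 R L M) = 0 ↔ ∃ ℓ, (d₁₂ R L M ℓ).1 = z.1.1 := by
  rw [Submodule.Quotient.mk_eq_zero]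
  constructor
  · rintro ⟨ℓ, hℓ⟩
    exact ⟨ℓ, congrArg Subtype.val hℓ⟩
  · rintro ⟨ℓ, hℓ⟩
    exact ⟨ℓ, Subtype.ext hℓ⟩

/-- Cocycles that are independent and generate modulo coboundaries yield a basis of `H²(L, M)`. -/
theorem exists_basis_H2 {ι : Type*} [Fintype ι] (w : ι → L →ₗ[R] L →ₗ[R] M)
    (hw : ∀ i, ∃ z : twoCocycle R L M, z.1.1 = w i)
    (hli : ∀ (g : ι → R) (ℓ : L →ₗ[R] M), ∑ i, g i • w i = (d₁₂ R L M ℓ).1 → ∀ i, g i = 0)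
    (hspan : ∀ z : twoCocycle R L M, ∃ (g : ι → R) (ℓ : L →ₗ[R] M),
      z.1.1 = ∑ i, g i • w i + (d₁₂ R L M ℓ).1) :
    ∃ b : Module.Basis ι R (H2 R L M), ∀ i, IsClassOf (w i) (b i) := by
  choose v hv using hw
  let q : twoCocycle R L M →ₗ[R] H2 R L M := Submodule.mkQ _
  have hval : ∀ g : ι → R, (∑ i, g i • v i).1.1 = ∑ i, g i • w i := by
    intro g
    simp only [AddSubmonoidClass.coe_finsetSum, SetLike.val_smul, hv]
  have hq : ∀ g : ι → R, q (∑ i, g i • v i) = ∑ i, g i • q (v i) := by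
    intro g
    simp only [map_sum, map_smul]
  have h1 : LinearIndependent R fun i => q (v i) := by
    rw [Fintype.linearIndependent_iff]
    intro g hg
    rw [← hq] at hg
    obtain ⟨ℓ, hℓ⟩ := (H2_mk_eq_zero_iff _).1 hg
    rw [hval] at hℓ
    exact hli g ℓ hℓ.symm
  have h2 : ⊤ ≤ Submodule.span R (Set.range fun i => q (v i)) := by
    rintro x -
    obtain ⟨z, rfl⟩ := Submodule.mkQ_surjective _ x
    obtain ⟨g, ℓ, h⟩ := hspan z
    have h3 : q (z - ∑ i, g i • v i) = 0 := by
      refine (H2_mk_eq_zero_iff _).2 ⟨ℓ, ?_⟩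
      rw [AddSubgroupClass.coe_sub, AddSubgroupClass.coe_sub, hval, h, add_sub_cancel_left]
    rw [map_sub, sub_eq_zero, hq] at h3
    change q z ∈ _
    rw [h3]
    exact sum_mem fun i _ => Submodule.smul_mem _ _ (Submodule.subset_span ⟨i, rfl⟩)
  exact ⟨Module.Basis.mk h1 h2, fun i => ⟨v i, hv i, (Module.Basis.mk_apply h1 h2 i).symm⟩⟩

end SecondCohomology

section Cohomology

variable {F : Type*} [Field F] {p m : ℕ} [CharP F p]

/-- The linear map `D` of `A(n)` with `∫ D(f) g = c(f, g)`. -/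
noncomputable def ofCochain (hp : 5 ≤ p) (c : HAlg F p m →ₗ[F] HAlg F p m →ₗ[F] TrivF F p m) :
    TruncPoly F p m →ₗ[F] TruncPoly F p m where
  -- The coefficient of x^a is found by pairing with the complementary monomial x^{σ-a}.
  toFun f := ofCoeff F p m fun a =>
    trivEquiv F p m (c (toH hp f) (toH hp (mono F p m fun k => p - 1 - a k)))
  map_add' f g := by
    simp only [ofCoeff, map_add, LinearMap.add_apply, add_smul, Finset.sum_add_distrib]
  map_smul' t f := by
    simp only [ofCoeff, map_smul, LinearMap.smul_apply, Finset.smul_sum, RingHom.id_apply,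
      smul_smul, smul_eq_mul]

theorem coeffN_ofCochain (hp : 5 ≤ p) (c : HAlg F p m →ₗ[F] HAlg F p m →ₗ[F] TrivF F p m)
    (f : TruncPoly F p m) {a : Idx m → ℕ} (ha : ∀ k, a k < p) :
    coeffN F p m a (ofCochain hp c f) =
      trivEquiv F p m (c (toH hp f) (toH hp (mono F p m fun k => p - 1 - a k))) :=
  coeffN_ofCoeff (fun a =>
    trivEquiv F p m (c (toH hp f) (toH hp (mono F p m fun k => p - 1 - a k)))) ha

theorem topCoeff_ofCochain_mul (hp : 5 ≤ p)
    (c : HAlg F p m →ₗ[F] HAlg F p m →ₗ[F] TrivF F p m) (f g : TruncPoly F p m) :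
    topCoeff F p m (ofCochain hp c f * g) = trivEquiv F p m (c (toH hp f) (toH hp g)) := by
  induction g using mono_induction with
  | hadd g g' hg hg' => simp only [mul_add, map_add, hg, hg']
  | hsmul t g hg => simp only [mul_smul_comm, map_smul, hg]
  | hmono b =>
    by_cases hb : ∀ k, b k < p
    · have h1 : b = fun k => p - 1 - (p - 1 - b k) := by
        ext k
        have := hb k
        omega
      have h2 : ∀ k, p - 1 - b k < p := fun k => by omega
      conv_lhs => rw [h1]
      rw [topCoeff_mul_mono _ h2, coeffN_ofCochain hp c f h2, ← h1]
    · push Not at hb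
      obtain ⟨k, hk⟩ := hb
      simp [mono_eq_zero hk]

theorem represents_ofCochain (hp : 5 ≤ p)
    (c : HAlg F p m →ₗ[F] HAlg F p m →ₗ[F] TrivF F p m) :
    Represents hp c (ofCochain hp c) :=
  fun f g _ _ => (topCoeff_ofCochain_mul hp c f g).symm

/-- Both conditions may be tested by pairing with the hyperplane, whose radical is the constants.
There the Leibniz rule is the cocycle identity, and D 1 pairs to zero because 1 is zero in H(n). -/
theorem ofCochain_mem (hp : 5 ≤ p) (hm : 1 ≤ m) {c : twoCochain F (HAlg F p m) (TrivF F p m)}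
    (hc : c ∈ twoCocycle F (HAlg F p m) (TrivF F p m)) :
    ofCochain hp c.1 ∈ derModConsts F p m := by
  rw [mem_twoCocycle_iff_of_trivial] at hc
  refine ⟨mem_consts_of_topCoeff_mul fun g _ => ?_, fun f g hf hg =>
    mem_consts_of_topCoeff_mul fun k hk => ?_⟩
  · rw [topCoeff_ofCochain_mul, toH_one hp hm, map_zero, LinearMap.zero_apply, map_zero]
  · have h := congrArg (trivEquiv F p m) (hc (toH hp f) (toH hp g) (toH hp k))
    rw [map_add] at h
    change trivEquiv F p m (c.1 _ _) = trivEquiv F p m (c.1 _ _) + trivEquiv F p m (c.1 _ _) at h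
    rw [sub_mul, add_mul, map_sub, map_add, topCoeff_bracket_mul, ← lie_skew f (ofCochain hp c.1 g), neg_mul,
      map_neg,
      topCoeff_bracket_mul, topCoeff_ofCochain_mul, topCoeff_ofCochain_mul,
      topCoeff_ofCochain_mul, toH_lie hp hf hg, toH_lie hp hg hk, toH_lie hp hf hk, h]
    ring

/-- The linear form on `H(n)` induced by `f ↦ ∫ g f`. -/
noncomputable def linForm (g : TruncPoly F p m) : HAlg F p m →ₗ[F] TrivF F p m :=
  (trivEquiv F p m).symm.toLinearMap ∘ₗ
    ∑ b : Expo p m, topCoeff F p m (g * mono F p m b.toNat) • coeffH F p m b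

theorem linForm_toH (hp : 5 ≤ p) {g f : TruncPoly F p m} (hg : topCoeff F p m g = 0)
    (hf : topCoeff F p m f = 0) :
    trivEquiv F p m (linForm g (toH hp f)) = topCoeff F p m (g * f) := by
  conv_rhs => rw [eq_sum_expo hf]
  simp only [linForm, LinearMap.comp_apply, LinearEquiv.coe_coe, LinearEquiv.apply_symm_apply,
    LinearMap.sum_apply, LinearMap.smul_apply, coeffH_toH hp _ hf, mul_add, Finset.mul_sum,
    mul_smul_comm, map_add, map_sum, map_smul, mul_one, hg, smul_zero, zero_add]
  exact Finset.sum_congr rfl fun b _ => by rw [smul_eq_mul, smul_eq_mul, mul_comm]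

theorem bilin_ext_toH (hp : 5 ≤ p) {c c' : HAlg F p m →ₗ[F] HAlg F p m →ₗ[F] TrivF F p m}
    (h : ∀ f g, topCoeff F p m f = 0 → topCoeff F p m g = 0 →
      trivEquiv F p m (c (toH hp f) (toH hp g)) = trivEquiv F p m (c' (toH hp f) (toH hp g))) :
    c = c' := by
  refine LinearMap.ext fun x => LinearMap.ext fun y => ?_
  obtain ⟨f, hf, rfl⟩ := toH_surjective hp x
  obtain ⟨g, hg, rfl⟩ := toH_surjective hp y
  exact (trivEquiv F p m).injective (h f g hf hg)

theorem trivEquiv_combination (hp : 5 ≤ p) (c : Idx m → F) (s κ : F) {f g : TruncPoly F p m}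
    (hf : topCoeff F p m f = 0) (hg : topCoeff F p m g = 0) :
    trivEquiv F p m ((∑ i, c i • omegaCochain F p m i + s • sigmaCochain F p m +
      κ • deltaCochain F p m) (toH hp f) (toH hp g)) =
      ∑ i, c i * topCoeff F p m (powDer F p m i f * g) + s * coeffN F p m 0 ⁅f, g⁆ +
        κ * topCoeff F p m (degDer F p m f * g) := by
  simp only [LinearMap.add_apply, LinearMap.sum_apply, LinearMap.smul_apply, map_add, map_sum,
    map_smul, smul_eq_mul]
  rw [represents_sigma hp f g hf hg, represents_delta hp f g hf hg, topCoeff_adL_top hp]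
  simp only [represents_omega hp _ f g hf hg]

theorem trivEquiv_d₁₂ (ℓ : HAlg F p m →ₗ[F] TrivF F p m) (x y : HAlg F p m) :
    trivEquiv F p m ((d₁₂ F (HAlg F p m) (TrivF F p m) ℓ).1 x y) =
      -trivEquiv F p m (ℓ ⁅x, y⁆) := by
  have h := d₁₂_apply_apply_ofTrivial F (HAlg F p m) (TrivF F p m) ℓ x y
  rw [← map_neg, ← h]
  rfl

/-- Every 2-cocycle is a combination of the given bilinear maps and a coboundary. -/
theorem exists_eq_combination (hp : 5 ≤ p) (hm : 1 ≤ m)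
    {z : twoCochain F (HAlg F p m) (TrivF F p m)}
    (hz : z ∈ twoCocycle F (HAlg F p m) (TrivF F p m)) :
    ∃ (c : Idx m → F) (s κ : F) (ℓ : HAlg F p m →ₗ[F] TrivF F p m),
      z.1 = ∑ i, c i • omegaCochain F p m i + s • sigmaCochain F p m +
        κ • deltaCochain F p m + (d₁₂ F (HAlg F p m) (TrivF F p m) ℓ).1 := by
  obtain ⟨g₀, c, κ, h⟩ := exists_of_mem_derModConsts hp (ofCochain_mem hp hm hz)
  -- Split off the multiple of x^σ: that part of ad g₀ represents a multiple of Σ, and the rest is a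
  -- coboundary. The linear form enters with a minus sign because the differential of ℓ is -ℓ of the
  -- bracket.
  let g₁ : TruncPoly F p m := g₀ - topCoeff F p m g₀ • mono F p m fun _ => p - 1
  have hg₁ : topCoeff F p m g₁ = 0 := by
    have h1 : topCoeff F p m (mono F p m fun _ => p - 1) = 1 := coeffN_mono_self fun _ => by omega
    rw [map_sub, map_smul, h1, smul_eq_mul, mul_one, sub_self]
  refine ⟨c, topCoeff F p m g₀, κ, -linForm g₁, bilin_ext_toH hp fun f g hf hg => ?_⟩
  rw [LinearMap.add_apply, LinearMap.add_apply, map_add, trivEquiv_combination hp _ _ _ hf hg,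
    trivEquiv_d₁₂, ← toH_lie hp hf hg, LinearMap.neg_apply, map_neg, neg_neg,
    linForm_toH hp hg₁ (topCoeff_bracket f g), represents_ofCochain hp z.1 f g hf hg]
  have h1 := topCoeff_mul_of_mem_consts (h f hf) hg
  rw [sub_mul, map_sub, sub_eq_zero] at h1
  have h2 : topCoeff F p m (g₁ * ⁅f, g⁆) =
      topCoeff F p m (⁅g₀, f⁆ * g) - topCoeff F p m g₀ * coeffN F p m 0 ⁅f, g⁆ := by
    rw [sub_mul, map_sub, smul_mul_assoc, map_smul, ← topCoeff_bracket_mul, ← topCoeff_bracket_mul,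
      smul_eq_mul, ← topCoeff_adL_top hp, adL_apply]
  rw [h1, h2]
  simp only [add_mul, map_add, Finset.sum_mul, map_sum, smul_mul_assoc, map_smul, smul_eq_mul]
  ring

/-- A combination of the given bilinear maps that is a coboundary is trivial. -/
theorem combination_eq_zero (hp : 5 ≤ p) (hm : 1 ≤ m) {c : Idx m → F} {s κ : F}
    {ℓ : HAlg F p m →ₗ[F] TrivF F p m}
    (h : ∑ i, c i • omegaCochain F p m i + s • sigmaCochain F p m + κ • deltaCochain F p m =
      (d₁₂ F (HAlg F p m) (TrivF F p m) ℓ).1) : (∀ i, c i = 0) ∧ s = 0 ∧ κ = 0 := by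
  -- A coboundary vanishes on pairs whose bracket is zero in H(n), so such pairs test the
  -- coefficients directly.
  have key : ∀ f g : TruncPoly F p m, topCoeff F p m f = 0 → topCoeff F p m g = 0 →
      toH hp ⁅f, g⁆ = 0 →
      ∑ i, c i * topCoeff F p m (powDer F p m i f * g) + s * coeffN F p m 0 ⁅f, g⁆ +
        κ * topCoeff F p m (degDer F p m f * g) = 0 := by
    intro f g hf hg hfg
    rw [← trivEquiv_combination hp _ _ _ hf hg, h, trivEquiv_d₁₂, ← toH_lie hp hf hg, hfg,
      map_zero, map_zero, neg_zero]
  have hone : topCoeff F p m (mono F p m fun _ => p - 1) = 1 := coeffN_mono_self fun _ => by omega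
  have hdeg : ∀ k, degDer F p m (var F p m k) = (-1 : F) • var F p m k := by
    intro k
    rw [var, degDer_mono, Finset.sum_pi_single']
    simp only [Finset.mem_univ, if_true, Nat.cast_one]
    congr 1
    norm_num
  have hsum : ∀ k g, ∑ i, c i * topCoeff F p m (powDer F p m i (var F p m k) * g) =
      c k * topCoeff F p m (mono F p m (Pi.single (conj k) (p - 1)) * g) := by
    intro k g
    rw [Finset.sum_eq_single k]
    · rw [powDer_var, if_pos rfl]
    · intro j _ hj
      rw [powDer_var, if_neg hj, zero_mul, map_zero, mul_zero]
    · simp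
  have hc : ∀ i, c i = 0 := by
    intro i
    -- This monomial lacks only x_{i'}, so it commutes with x_i and is completed to x^σ by the
    -- factor x_{i'}^{p-1} of `powDer i`. Its product with x_i is zero, which removes the Δ term.
    let a : Idx m → ℕ := fun k => if k = conj i then 0 else p - 1
    have hai : a (conj i) = 0 := if_pos rfl
    have hbr : ⁅var F p m i, mono F p m a⁆ = 0 := by
      rw [var_bracket, partialD_mono, hai, Nat.cast_zero, zero_smul, smul_zero]
    have h1 := key (var F p m i) (mono F p m a) (topCoeff_var hp i)
      (topCoeff_mono_of_ne (k := conj i) (by omega)) (by rw [hbr, map_zero])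
    have h2 : Pi.single (conj i) (p - 1) + a = fun _ => p - 1 := by
      ext k
      simp only [Pi.add_apply, Pi.single_apply, a]
      split_ifs <;> omega
    have h3 : var F p m i * mono F p m a = 0 := by
      rw [var, mono_mul]
      refine mono_eq_zero (k := i) ?_
      simp only [Pi.add_apply, Pi.single_eq_same, a, if_neg (conj_ne i).symm]
      omega
    rwa [hsum, hbr, map_zero, mul_zero, add_zero, hdeg, smul_mul_assoc, h3, smul_zero, map_zero,
      mul_zero, add_zero, mono_mul, h2, hone, mul_one] at h1
  simp only [hc, zero_mul, Finset.sum_const_zero, zero_add] at key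
  let k₀ : Fin m := ⟨0, hm⟩
  have hs : s = 0 := by
    let k : Idx m := .inl k₀
    have hbr : ⁅var F p m k, var F p m (conj k)⁆ = (sgn k : F) • 1 := by
      rw [bracket_var_var', symp_conj]
    have h1 := key _ _ (topCoeff_var hp k) (topCoeff_var hp (conj k))
      (by rw [hbr, map_smul, toH_one hp hm, smul_zero])
    have h2 : topCoeff F p m (degDer F p m (var F p m k) * var F p m (conj k)) = 0 := by
      rw [hdeg, smul_mul_assoc, map_smul, topCoeff_var_mul_var hp, smul_zero]
    rw [hbr, h2, mul_zero, add_zero, map_smul, ← mono_zero, coeffN_mono_self (fun _ => by simp only [Pi.zero_apply]; omega),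
      smul_eq_mul, mul_one] at h1
    exact (mul_eq_zero.1 h1).resolve_right (sgn_cast_ne_zero k)
  simp only [hs, zero_mul, zero_add] at key
  refine ⟨hc, hs, ?_⟩
  -- Equal exponents on conjugate variables make x^a commute with its complement. The exponent 2 is
  -- taken because x_k x_{k'} has degree 0 and would not detect Δ; here the degree is 2, nonzero in
  -- F.
  let a : Idx m → ℕ := Pi.single (.inl k₀) 2 + Pi.single (.inr k₀) 2
  have ha : ∀ i, a (.inl i) = a (.inr i) := by
    intro i
    simp [a, Pi.single_apply]
  have hlt : ∀ k, a k ≤ 2 := by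
    rintro (i | i) <;> simp only [a, Pi.add_apply, Pi.single_apply, Sum.inl.injEq, Sum.inr.injEq,
      reduceCtorEq, if_false] <;> split_ifs <;> omega
  have hbr : ⁅mono F p m a, mono F p m fun k => p - 1 - a k⁆ = 0 := by
    rw [bracket_mono]
    refine Finset.sum_eq_zero fun i _ => ?_
    rw [ha, sub_self, zero_smul]
  have h1 := key (mono F p m a) (mono F p m fun k => p - 1 - a k)
    (topCoeff_mono_of_ne (k := .inl k₀) (by have := hlt (.inl k₀); omega))
    (topCoeff_mono_of_ne (k := .inl k₀) (by simp [a]; omega)) (by rw [hbr, map_zero])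
  have hap : ∀ k, a k < p := fun k => by have := hlt k; omega
  have hsum2 : ∑ j, a j = 4 := by
    simp only [a, sum_add_single]
    rw [Finset.sum_pi_single']
    simp
  rw [topCoeff_mul_mono _ hap, degDer_mono, map_smul, coeffN_mono_self hap, smul_eq_mul, mul_one,
    hsum2] at h1
  refine (mul_eq_zero.1 h1).resolve_right ?_
  push_cast
  norm_num
  exact two_ne_zero_of_five_le hp

theorem exists_omegaCocycle (hp : 5 ≤ p) (i : Idx m) :
    ∃ z : twoCocycle F (HAlg F p m) (TrivF F p m), z.1.1 = omegaCochain F p m i :=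
  ⟨⟨⟨omegaCochain F p m i, omegaCochain_mem hp i⟩,
    represents_mem_twoCocycle (represents_omega hp i) (powDer_lie i)⟩, rfl⟩

theorem exists_sigmaCocycle (hp : 5 ≤ p) :
    ∃ z : twoCocycle F (HAlg F p m) (TrivF F p m), z.1.1 = sigmaCochain F p m :=
  ⟨⟨⟨sigmaCochain F p m, sigmaCochain_mem hp⟩,
    represents_mem_twoCocycle (represents_sigma hp) (adL_lie _)⟩, rfl⟩

theorem exists_deltaCocycle (hp : 5 ≤ p) (hm : 1 ≤ m) (hn : (2 * m + 4 : F) = 0) :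
    ∃ z : twoCocycle F (HAlg F p m) (TrivF F p m), z.1.1 = deltaCochain F p m :=
  ⟨⟨⟨deltaCochain F p m, (deltaCochain_mem_iff hp hm).2 hn⟩,
    represents_mem_twoCocycle (represents_delta hp) degDer_lie⟩, rfl⟩

theorem exists_basis_of_ne (hp : 5 ≤ p) (hm : 1 ≤ m) (hn : (2 * m + 4 : F) ≠ 0) :
    ∃ b : Module.Basis (Idx m ⊕ Unit) F (H2 F (HAlg F p m) (TrivF F p m)),
      (∀ i, IsClassOf (omegaCochain F p m i) (b (.inl i))) ∧
        IsClassOf (sigmaCochain F p m) (b (.inr ())) := by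
  let w : Idx m ⊕ Unit → HAlg F p m →ₗ[F] HAlg F p m →ₗ[F] TrivF F p m :=
    Sum.elim (omegaCochain F p m) fun _ => sigmaCochain F p m
  have hval : ∀ g : Idx m ⊕ Unit → F, ∑ i, g i • w i =
      ∑ i, g (.inl i) • omegaCochain F p m i + g (.inr ()) • sigmaCochain F p m +
        (0 : F) • deltaCochain F p m := by
    intro g
    rw [zero_smul, add_zero, Fintype.sum_sum_type, Fintype.sum_unique (ι := Unit)]
    rfl
  have h : ∃ b : Module.Basis (Idx m ⊕ Unit) F (H2 F (HAlg F p m) (TrivF F p m)),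
      ∀ i, IsClassOf (w i) (b i) := by
    refine exists_basis_H2 w ?_ ?_ ?_
    · rintro (i | ⟨⟩)
      exacts [exists_omegaCocycle hp i, exists_sigmaCocycle hp]
    · intro g ℓ h
      rw [hval] at h
      obtain ⟨h2, h3, -⟩ := combination_eq_zero hp hm h
      rintro (i | ⟨⟩)
      exacts [h2 i, h3]
    · intro z
      obtain ⟨c, s, κ, ℓ, h⟩ := exists_eq_combination hp hm z.2
      -- All other terms are alternating, so a nonzero κ would make Δ alternating.
      have hκ : κ = 0 := by
        by_contra hκ
        refine hn ((deltaCochain_mem_iff hp hm).1 ?_)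
        have h1 : κ • deltaCochain F p m = z.1.1 -
            (d₁₂ F (HAlg F p m) (TrivF F p m) ℓ).1 - ∑ i, c i • omegaCochain F p m i -
            s • sigmaCochain F p m := by
          rw [h]
          abel
        have h2 : κ • deltaCochain F p m ∈ twoCochain F (HAlg F p m) (TrivF F p m) := by
          rw [h1]
          exact sub_mem (sub_mem (sub_mem z.1.2 (d₁₂ F (HAlg F p m) (TrivF F p m) ℓ).2)
            (sum_mem fun i _ => Submodule.smul_mem _ _ (omegaCochain_mem hp i)))
            (Submodule.smul_mem _ _ (sigmaCochain_mem hp))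
        have h3 := Submodule.smul_mem _ κ⁻¹ h2
        rwa [smul_smul, inv_mul_cancel₀ hκ, one_smul] at h3
      exact ⟨Sum.elim c fun _ => s, ℓ, by rw [hval, h, hκ]; rfl⟩
  obtain ⟨b, hb⟩ := h
  exact ⟨b, fun i => hb (.inl i), hb (.inr ())⟩

theorem exists_basis_of_eq (hp : 5 ≤ p) (hm : 1 ≤ m) (hn : (2 * m + 4 : F) = 0) :
    ∃ b : Module.Basis (Idx m ⊕ Unit ⊕ Unit) F (H2 F (HAlg F p m) (TrivF F p m)),
      (∀ i, IsClassOf (omegaCochain F p m i) (b (.inl i))) ∧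
        IsClassOf (sigmaCochain F p m) (b (.inr (.inl ()))) ∧
        IsClassOf (deltaCochain F p m) (b (.inr (.inr ()))) := by
  let w : Idx m ⊕ Unit ⊕ Unit → HAlg F p m →ₗ[F] HAlg F p m →ₗ[F] TrivF F p m :=
    Sum.elim (omegaCochain F p m)
      (Sum.elim (fun _ => sigmaCochain F p m) fun _ => deltaCochain F p m)
  have hval : ∀ g : Idx m ⊕ Unit ⊕ Unit → F, ∑ i, g i • w i =
      ∑ i, g (.inl i) • omegaCochain F p m i + g (.inr (.inl ())) • sigmaCochain F p m +
        g (.inr (.inr ())) • deltaCochain F p m := by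
    intro g
    have h : ∑ i : Unit ⊕ Unit, g (.inr i) • w (.inr i) =
        g (.inr (.inl ())) • sigmaCochain F p m + g (.inr (.inr ())) • deltaCochain F p m := by
      rw [Fintype.sum_sum_type, Fintype.sum_unique, Fintype.sum_unique]
      rfl
    rw [Fintype.sum_sum_type, h, add_assoc]
    rfl
  have h : ∃ b : Module.Basis (Idx m ⊕ Unit ⊕ Unit) F (H2 F (HAlg F p m) (TrivF F p m)),
      ∀ i, IsClassOf (w i) (b i) := by
    refine exists_basis_H2 w ?_ ?_ ?_
    · rintro (i | ⟨⟨⟩⟩ | ⟨⟨⟩⟩)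
      exacts [exists_omegaCocycle hp i, exists_sigmaCocycle hp, exists_deltaCocycle hp hm hn]
    · intro g ℓ h
      rw [hval] at h
      obtain ⟨h2, h3, h4⟩ := combination_eq_zero hp hm h
      rintro (i | ⟨⟨⟩⟩ | ⟨⟨⟩⟩)
      exacts [h2 i, h3, h4]
    · intro z
      obtain ⟨c, s, κ, ℓ, h⟩ := exists_eq_combination hp hm z.2
      exact ⟨Sum.elim c (Sum.elim (fun _ => s) fun _ => κ), ℓ, by rw [hval, h]; rfl⟩
  obtain ⟨b, hb⟩ := h
  exact ⟨b, fun i => hb (.inl i), hb (.inr (.inl ())), hb (.inr (.inr ()))⟩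

theorem finrank_H2_of_ne (hp : 5 ≤ p) (hm : 1 ≤ m) (hn : (2 * m + 4 : F) ≠ 0) :
    Module.finrank F (H2 F (HAlg F p m) (TrivF F p m)) = 2 * m + 1 :=
  Exists.elim (exists_basis_of_ne hp hm hn) fun b _ => by
    rw [Module.finrank_eq_card_basis b]
    simp only [Fintype.card_sum, Fintype.card_fin, Fintype.card_unit]
    ring

theorem finrank_H2_of_eq (hp : 5 ≤ p) (hm : 1 ≤ m) (hn : (2 * m + 4 : F) = 0) :
    Module.finrank F (H2 F (HAlg F p m) (TrivF F p m)) = 2 * m + 2 :=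
  Exists.elim (exists_basis_of_eq hp hm hn) fun b _ => by
    rw [Module.finrank_eq_card_basis b]
    simp only [Fintype.card_sum, Fintype.card_fin, Fintype.card_unit]
    ring

theorem modEq_neg_four_iff : ((2 * m : ℕ) : ℤ) ≡ -4 [ZMOD (p : ℤ)] ↔ (2 * m + 4 : F) = 0 := by
  rw [Int.modEq_comm, Int.modEq_iff_dvd, ← CharP.intCast_eq_zero_iff F p]
  push_cast
  rw [sub_neg_eq_add]

end Cohomology

end HamiltonianLie

theorem mainTheorem6 (F : Type*) [Field F] (p : ℕ) [Fact p.Prime] [CharP F p] (hp2 : p ≠ 2)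
    (hp3 : p ≠ 3) (m : ℕ) (hm : 1 ≤ m) :
    (¬ ((2 * m : ℕ) : ℤ) ≡ -4 [ZMOD (p : ℤ)] →
      (∃ b : Module.Basis (HamiltonianLie.Idx m ⊕ Unit) F
          (HamiltonianLie.H2 F (HamiltonianLie.HAlg F p m) (HamiltonianLie.TrivF F p m)),
        (∀ i, HamiltonianLie.IsClassOf (HamiltonianLie.omegaCochain F p m i) (b (.inl i))) ∧
        HamiltonianLie.IsClassOf (HamiltonianLie.sigmaCochain F p m) (b (.inr ()))) ∧
      Module.finrank F
        (HamiltonianLie.H2 F (HamiltonianLie.HAlg F p m) (HamiltonianLie.TrivF F p m)) =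
          2 * m + 1) ∧
    (((2 * m : ℕ) : ℤ) ≡ -4 [ZMOD (p : ℤ)] →
      (∃ b : Module.Basis (HamiltonianLie.Idx m ⊕ Unit ⊕ Unit) F
          (HamiltonianLie.H2 F (HamiltonianLie.HAlg F p m) (HamiltonianLie.TrivF F p m)),
        (∀ i, HamiltonianLie.IsClassOf (HamiltonianLie.omegaCochain F p m i) (b (.inl i))) ∧
        HamiltonianLie.IsClassOf (HamiltonianLie.sigmaCochain F p m) (b (.inr (.inl ()))) ∧
        HamiltonianLie.IsClassOf (HamiltonianLie.deltaCochain F p m) (b (.inr (.inr ())))) ∧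
      Module.finrank F
        (HamiltonianLie.H2 F (HamiltonianLie.HAlg F p m) (HamiltonianLie.TrivF F p m)) =
          2 * m + 2) ∧
    (HamiltonianLie.deltaCochain F p m ∈ LieModule.Cohomology.twoCochain F
        (HamiltonianLie.HAlg F p m) (HamiltonianLie.TrivF F p m) ↔
      ((2 * m : ℕ) : ℤ) ≡ -4 [ZMOD (p : ℤ)]) := by
  have hp : 5 ≤ p := by
    have hprime : p.Prime := Fact.out
    have h2 := hprime.two_le
    have h4 : p ≠ 4 := by
      rintro rfl
      exact absurd hprime (by decide)
    omega
  have hiff := HamiltonianLie.modEq_neg_four_iff (F := F) (p := p) (m := m)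
  exact ⟨fun hn => have hn' := fun h => hn (hiff.2 h)
      ⟨HamiltonianLie.exists_basis_of_ne hp hm hn', HamiltonianLie.finrank_H2_of_ne hp hm hn'⟩,
    fun hn => ⟨HamiltonianLie.exists_basis_of_eq hp hm (hiff.1 hn),
      HamiltonianLie.finrank_H2_of_eq hp hm (hiff.1 hn)⟩,
    (HamiltonianLie.deltaCochain_mem_iff hp hm).trans hiff.symm⟩
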